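/- Let $\Phi=\{x_i\}_{i\in\mathbb N}$ be a homogeneous Poisson point process of intensity $\lambda>0$ in $\mathbb{R}^2$, let $x\in\mathbb{R}^2$ (the receiver), let $\alpha>2$ and $0<\phi\le 2\pi$, and let the channel gains $h_i$ be almost surely positive i.i.d. copies of a random variable $h$, independent of $\Phi$, with $\bar h_{2/\alpha}=E[h^{2/\alpha}]<\infty$. The interferers are the nodes $x_i$ for which the angle in $[0,2\pi)$ of the vector $x_i-x$, measured counterclockwise from the positive horizontal axis, is at most $\phi$; the interference power of node $i$ is $I_i=h_i\|x-x_i\|^{-\alpha}$. Put $\Lambda_2(z)=\tfrac12\,\phi\lambda\,\bar h_{2/\alpha}\,z^{2/\alpha}$ for $z\ge 0$. Then almost surely the interference powers of the interferers are pairwise distinct and can be listed as a strictly decreasing infinite sequence $I_{(1)}>I_{(2)}>\cdots$, and for every $n\ge 1$ the random variable $z_n=I_{(n)}^{-1}$, the inverse of the $n$-th dominant interference power, has the probability density function $$f^{\phi}_{z_n}(z)=\frac{2\,e^{-\Lambda_2(z)}\,\Lambda_2(z)^n}{\alpha\, z\,(n-1)!}\quad (z>0),\qquad f^{\phi}_{z_n}(z)=0\quad(z\le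 0).$$ Moreover, the points $\|x_i-x\|^{\alpha}/h_i$, taken over the interferers, form a Poisson point process on $\mathbb{R}^+$ whose intensity measure has density $\tfrac{\phi\lambda}{\alpha}\bar h_{2/\alpha}z^{2/\alpha-1}$, and so assigns to $[0,z]$ the mass $\Lambda_2(z)$ for every $z\ge 0$. -/

import Mathlib

open MeasureTheory ProbabilityTheory
open scoped ENNReal

noncomputable section

/-- The random counting measure `N` is a Poisson point process with intensity measure `ν`:
the number of points in a measurable set `B` of finite intensity is Poisson distributed with mean
`ν B`, and the numbers of points in finitely many pairwise disjoint such sets are independent. -/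
structure IsPoissonPointProcess {Ω E : Type*} [MeasurableSpace Ω] [MeasurableSpace E]
    (N : Ω → Measure E) (ν : Measure E) (P : Measure Ω) : Prop where
  hasLaw_count : ∀ B : Set E, MeasurableSet B → ν B < ∞ →
    HasLaw (fun ω => N ω B)
      ((poissonMeasure (ν B).toNNReal).map (fun k : ℕ => (k : ℝ≥0∞))) P
  iIndepFun_count : ∀ (k : ℕ) (B : Fin k → Set E),
    (∀ j, MeasurableSet (B j)) → (∀ j, ν (B j) < ∞) → Pairwise (fun i j => Disjoint (B i) (B j)) →
    iIndepFun (fun j ω => N ω (B j)) P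

/-- The counting measure of a family of points (multiplicities are counted). -/
def countingMeasure {ι E : Type*} [MeasurableSpace E] (p : ι → E) : Measure E :=
  Measure.sum fun i => Measure.dirac (p i)

/-- The angle in `[0, 2π)` of a planar vector, measured counterclockwise from the positive
horizontal axis. -/
def directionAngle (v : EuclideanSpace ℝ (Fin 2)) : ℝ :=
  toIcoMod Real.two_pi_pos 0 (Complex.arg ⟨v 0, v 1⟩)

/-- The indices of the nodes seen by a receiver at `x` within the reception angle `φ`. -/
def interferers (φ : ℝ) (x : EuclideanSpace ℝ (Fin 2))
    (X : ℕ → EuclideanSpace ℝ (Fin 2)) : Set ℕ :=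
  {i | directionAngle (X i - x) ≤ φ}

/-- The interference power received at `x` from a node at `y` with channel gain `g`, for the
path-loss exponent `α`. -/
def interferencePower (α : ℝ) (x y : EuclideanSpace ℝ (Fin 2)) (g : ℝ) : ℝ :=
  g * ‖x - y‖ ^ (-α)

/-- The `n`-th largest value (`n ≥ 1`, with multiplicity) of the family `(a i)`, `i ∈ S`: the
largest threshold that is reached by at least `n` members of the family. -/
def nthLargest {ι : Type*} (S : Set ι) (a : ι → ℝ) (n : ℕ) : ℝ :=
  sSup {t : ℝ | (n : ℕ∞) ≤ {i | i ∈ S ∧ t ≤ a i}.encard}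

/-- The `n`-th dominant interference power at a receiver at `x` with reception angle `φ`, for
nodes at the points `X i` with channel gains `h i`. -/
def dominantPower (α φ : ℝ) (x : EuclideanSpace ℝ (Fin 2))
    (X : ℕ → EuclideanSpace ℝ (Fin 2)) (h : ℕ → ℝ) (n : ℕ) : ℝ :=
  nthLargest (interferers φ x X) (fun i => interferencePower α x (X i) (h i)) n

/-- The point configuration `{‖X i - x‖ ^ α / h i}` on the power axis, over the interferers `i`. -/
def powerAxisProcess (α φ : ℝ) (x : EuclideanSpace ℝ (Fin 2))
    (X : ℕ → EuclideanSpace ℝ (Fin 2)) (h : ℕ → ℝ) : Measure ℝ :=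
  countingMeasure fun i : interferers φ x X => ‖X i - x‖ ^ α / h i

/-- `Λ₂(z) = (φ λ / 2) m z ^ (2 / α)`, where `m` is the moment of order `2 / α` of the gain. -/
def cumulativeIntensity (lam α φ m z : ℝ) : ℝ :=
  φ * lam / 2 * m * z ^ (2 / α)

/-- The measure on the positive half-line with density `(φ λ / α) m z ^ (2 / α - 1)`. -/
def powerAxisIntensity (lam α φ m : ℝ) : Measure ℝ :=
  (volume.restrict (Set.Ioi 0)).withDensity
    fun z => ENNReal.ofReal (φ * lam / α * m * z ^ (2 / α - 1))

/-- The probability density of the inverse of the `n`-th dominant interference power. -/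
def inverseDominantPDF (lam α φ m : ℝ) (n : ℕ) (z : ℝ) : ℝ :=
  if 0 < z then
    2 * Real.exp (-cumulativeIntensity lam α φ m z) * cumulativeIntensity lam α φ m z ^ n /
      (α * z * (Nat.factorial (n - 1) : ℝ))
  else 0

end

/-! Everything rests on the Laplace functional. A Poisson process `N` with σ-finite intensity `ν`
satisfies `E exp(-∫ u dN) = exp(-∫ (1 - e⁻ᵘ) dν)` for measurable `u ≥ 0`
(`IsPoissonPointProcess.lintegral_expNeg`). Conversely, this formula for all such `u` forces a
measurable random measure to be Poisson (`IsPoissonPointProcess.of_lintegral_expNeg`). Averaging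
over independent marks only replaces `e⁻ᵘ` by its mean over the mark, so the nodes marked by their
gains have the functional with intensity `ν ⊗ μ` (`IsPoissonPointProcess.lintegral_expNeg_marked`).

Selecting the sector and mapping `(y, g)` to `‖y - x‖ ^ α / g` is absorbed into the test function.
The power axis process is therefore Poisson, and its intensity is the image measure. For a gain `g`,
the points of value at most `z` come from a sector of radius `(z g) ^ (1 / α)` and area `(φ / 2) (z
g) ^ (2 / α)`; integrating over `g` gives `Λ₂(z)` (`map_restrict_sector`).

Interference powers are reciprocals of these points, so for `z > 0` the event `zₙ ≤ z` says that
`[0, z]` contains at least `n` points. Its probability is a Poisson tail with mean `Λ₂(z)`, whose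
derivative telescopes to the stated density. The listing in decreasing order needs four almost sure
facts: the points are positive, locally finite, infinite in number and without ties. The last
follows by cutting the axis into cells of small intensity, since a cell of intensity `r` holds two
points with probability at most `r²`. -/

open scoped NNReal

/-! ### The exponential on `[0, ∞]` and the Poisson generating function. -/

/-- The function `a ↦ e⁻ᵃ` on `[0, ∞]`. -/
noncomputable def expNeg (a : ℝ≥0∞) : ℝ≥0∞ := EReal.exp (-(a : EReal))

lemma continuous_expNeg : Continuous expNeg :=
  ENNReal.continuous_exp.comp (continuous_neg.comp continuous_coe_ennreal_ereal)

lemma measurable_expNeg : Measurable expNeg := continuous_expNeg.measurable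

lemma antitone_expNeg : Antitone expNeg := fun _ _ hab =>
  EReal.exp_monotone (EReal.neg_le_neg_iff.2 (EReal.coe_ennreal_le_coe_ennreal_iff.2 hab))

@[simp] lemma expNeg_zero : expNeg 0 = 1 := by simp [expNeg]

@[simp] lemma expNeg_top : expNeg ∞ = 0 := by simp [expNeg]

lemma expNeg_injective : Function.Injective expNeg := fun a b hab => by
  have := EReal.exp_strictMono.injective hab
  simpa using this

lemma expNeg_ofReal {r : ℝ} (hr : 0 ≤ r) :
    expNeg (ENNReal.ofReal r) = ENNReal.ofReal (Real.exp (-r)) := by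
  rw [expNeg, EReal.coe_ennreal_ofReal, max_eq_left hr, ← EReal.coe_neg, EReal.exp_coe]

lemma expNeg_le_one (a : ℝ≥0∞) : expNeg a ≤ 1 := by
  simpa using antitone_expNeg (zero_le : 0 ≤ a)

lemma expNeg_ne_top (a : ℝ≥0∞) : expNeg a ≠ ∞ :=
  ne_top_of_le_ne_top ENNReal.one_ne_top (expNeg_le_one a)

lemma expNeg_add (a b : ℝ≥0∞) : expNeg (a + b) = expNeg a * expNeg b := by
  rw [expNeg, expNeg, expNeg, ← EReal.exp_add, EReal.coe_ennreal_add, EReal.neg_add, sub_eq_add_neg]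
  · left; exact EReal.coe_ennreal_ne_bot a
  · right; exact EReal.coe_ennreal_ne_bot b

lemma expNeg_sum {ι : Type*} (s : Finset ι) (f : ι → ℝ≥0∞) :
    expNeg (∑ i ∈ s, f i) = ∏ i ∈ s, expNeg (f i) := by
  classical
  induction s using Finset.induction_on with
  | empty => simp
  | insert a s ha ih => rw [Finset.sum_insert ha, Finset.prod_insert ha, expNeg_add, ih]

lemma expNeg_mul_natCast (c : ℝ≥0∞) (k : ℕ) : expNeg (c * k) = expNeg c ^ k := by
  have := expNeg_sum (Finset.range k) (fun _ => c)
  simpa [mul_comm] using this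

/-- The inverse of `expNeg` on `[0, 1]`. -/
noncomputable def negLog (p : ℝ≥0∞) : ℝ≥0∞ := (-(ENNReal.log p)).toENNReal

lemma measurable_negLog : Measurable negLog :=
  measurable_ereal_toENNReal.comp (measurable_neg.comp ENNReal.measurable_log)

lemma expNeg_negLog {p : ℝ≥0∞} (hp : p ≤ 1) : expNeg (negLog p) = p := by
  have : 0 ≤ -(ENNReal.log p) := by
    rw [EReal.neg_nonneg]
    simpa using ENNReal.log_monotone hp
  rw [expNeg, negLog, EReal.coe_toENNReal this, neg_neg, ENNReal.exp_log]

lemma lintegral_pow_poissonMeasure (r : ℝ≥0) {q : ℝ≥0∞} (hq : q ≤ 1) :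
    ∫⁻ k, q ^ k ∂(poissonMeasure r) = expNeg ((1 - q) * r) := by
  lift q to ℝ≥0 using ne_top_of_le_ne_top ENNReal.one_ne_top hq
  have hq' : (q : ℝ) ≤ 1 := by exact_mod_cast hq
  have h1 : HasSum (fun n : ℕ => Real.exp (-r) * (r : ℝ) ^ n / n.factorial * (q : ℝ) ^ n)
      (Real.exp (-((1 - q) * r))) := by
    have h := (NormedSpace.expSeries_div_hasSum_exp ((r : ℝ) * q)).mul_left (Real.exp (-r))
    rw [← Real.exp_eq_exp_ℝ, ← Real.exp_add] at h
    convert! h using 1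
    · ext n; rw [mul_pow]; ring
    · congr 1; ring
  have h2 : ((1 - q : ℝ≥0∞) * r) = ENNReal.ofReal ((1 - q) * r) := by
    rw [ENNReal.ofReal_mul (by linarith), ENNReal.ofReal_sub _ q.coe_nonneg]
    simp
  rw [h2, expNeg_ofReal (mul_nonneg (by linarith) r.coe_nonneg), ← h1.tsum_eq,
    ENNReal.ofReal_tsum_of_nonneg (fun n => by positivity) h1.summable, poissonMeasure,
    lintegral_sum_measure]
  refine tsum_congr fun n => ?_
  rw [lintegral_smul_measure, lintegral_dirac, ENNReal.ofReal_mul (by positivity),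
    ENNReal.ofReal_pow q.coe_nonneg]
  simp

/-! ### The Laplace functional of a Poisson point process. -/

section Laplace

variable {Ω E : Type*} [MeasurableSpace Ω] [MeasurableSpace E]

lemma lintegral_expNeg_mul_poissonMeasure (c : ℝ≥0∞) (r : ℝ≥0) :
    ∫⁻ a, expNeg (c * a) ∂((poissonMeasure r).map (fun k : ℕ => (k : ℝ≥0∞))) =
      expNeg ((1 - expNeg c) * r) := by
  rw [lintegral_map (f := fun a => expNeg (c * a))
    (measurable_expNeg.comp (measurable_const.mul measurable_id)) (by fun_prop)]
  simp_rw [expNeg_mul_natCast]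
  exact lintegral_pow_poissonMeasure r (expNeg_le_one c)

namespace IsPoissonPointProcess

variable {N : Ω → Measure E} {ν : Measure E} {P : Measure Ω}

lemma lintegral_expNeg_mul_count (hN : IsPoissonPointProcess N ν P) (c : ℝ≥0∞)
    {B : Set E} (hB : MeasurableSet B) (hB' : ν B < ∞) :
    ∫⁻ ω, expNeg (c * N ω B) ∂P = expNeg ((1 - expNeg c) * ν B) := by
  rw [(hN.hasLaw_count B hB hB').lintegral_comp (f := fun a => expNeg (c * a))
      (measurable_expNeg.comp (measurable_const.mul measurable_id)).aemeasurable,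
    lintegral_expNeg_mul_poissonMeasure, ENNReal.coe_toNNReal hB'.ne]

/-- The level sets of `f` are disjoint, so their counts are independent and the expectation factors
into Poisson generating functions. -/
lemma lintegral_expNeg_simpleFunc (hN : IsPoissonPointProcess N ν P) (hNm : Measurable N)
    (f : SimpleFunc E ℝ≥0∞) (hf : ν (Function.support f) < ∞) :
    ∫⁻ ω, expNeg (∫⁻ y, f y ∂(N ω)) ∂P = expNeg (∫⁻ y, (1 - expNeg (f y)) ∂ν) := by
  classical
  have hsum : ∀ (M : Measure E) (g : ℝ≥0∞ → ℝ≥0∞), g 0 = 0 →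
      ∫⁻ y, g (f y) ∂M = ∑ c ∈ f.range.erase 0, g c * M (f ⁻¹' {c}) := by
    intro M g hg
    rw [Finset.sum_erase _ (by rw [hg, zero_mul]), ← SimpleFunc.map_lintegral,
      ← SimpleFunc.lintegral_eq_lintegral, SimpleFunc.coe_map]
    rfl
  -- The level set of `0` may have infinite intensity, but it contributes to neither side.
  set s := f.range.erase 0
  have hfin : ∀ c ∈ s, ν (f ⁻¹' {c}) < ∞ := by
    intro c hc
    refine (measure_mono fun y hy => ?_).trans_lt hf
    simp only [Set.mem_preimage, Set.mem_singleton_iff] at hy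
    simp only [Function.mem_support, hy]
    exact (Finset.mem_erase.1 hc).1
  have hmeas : ∀ c, MeasurableSet (f ⁻¹' {c}) := fun c => f.measurableSet_preimage _
  let e := s.equivFin
  have hind : iIndepFun (fun j ω =>
      expNeg ((e.symm j : ℝ≥0∞) * N ω (f ⁻¹' {(e.symm j : ℝ≥0∞)}))) P := by
    refine (hN.iIndepFun_count s.card (fun j => f ⁻¹' {(e.symm j : ℝ≥0∞)}) (fun j => hmeas _)
      (fun j => hfin _ (e.symm j).2) ?_).comp (fun j a => expNeg ((e.symm j : ℝ≥0∞) * a)) ?_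
    · intro i j hij
      refine Disjoint.preimage _ (Set.disjoint_singleton.2 fun h => hij ?_)
      exact e.symm.injective (Subtype.ext h)
    · intro j
      exact measurable_expNeg.comp (measurable_const.mul measurable_id)
  have key := lintegral_prod_eq_prod_lintegral_of_indepFun Finset.univ _ hind fun j =>
    measurable_expNeg.comp (measurable_const.mul ((Measure.measurable_coe (hmeas _)).comp hNm))
  have hre : ∀ F : ℝ≥0∞ → ℝ≥0∞, ∏ j, F (e.symm j) = ∏ c ∈ s, F c := by
    intro F
    rw [Equiv.prod_comp e.symm (fun c : s => F c), Finset.prod_coe_sort s F]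
  have h1 : ∀ ω, ∫⁻ y, f y ∂(N ω) = ∑ c ∈ s, c * N ω (f ⁻¹' {c}) := fun ω =>
    hsum (N ω) id rfl
  simp_rw [h1, hsum ν (fun c => 1 - expNeg c) (by simp), expNeg_sum]
  have hre' := fun ω => hre fun c => expNeg (c * N ω (f ⁻¹' {c}))
  rw [← lintegral_congr hre']
  refine key.trans ?_
  rw [hre (fun c => ∫⁻ ω, expNeg (c * N ω (f ⁻¹' {c})) ∂P)]
  exact Finset.prod_congr rfl fun c hc =>
    hN.lintegral_expNeg_mul_count c (hmeas c) (hfin c hc)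

/-- Simple functions cut off to the spanning sets of `ν` increase to `u` and have support of finite
intensity. Both sides pass to the limit, the left one dominated by `1`. -/
theorem lintegral_expNeg [IsProbabilityMeasure P] [SigmaFinite ν]
    (hN : IsPoissonPointProcess N ν P) (hNm : Measurable N)
    {u : E → ℝ≥0∞} (hu : Measurable u) :
    ∫⁻ ω, expNeg (∫⁻ y, u y ∂(N ω)) ∂P = expNeg (∫⁻ y, (1 - expNeg (u y)) ∂ν) := by
  let f : ℕ → SimpleFunc E ℝ≥0∞ := fun n =>
    (SimpleFunc.eapprox u n).restrict (spanningSets ν n)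
  have hfa : ∀ n y, f n y = (spanningSets ν n).indicator (SimpleFunc.eapprox u n) y := fun n y => by
    rw [SimpleFunc.restrict_apply _ (measurableSet_spanningSets ν n)]
  have hmono : ∀ y, Monotone fun n => f n y := by
    intro y m n hmn
    simp only [hfa]
    refine (Set.indicator_le_indicator_of_subset (monotone_spanningSets ν hmn)
      (fun _ => zero_le) y).trans ?_
    exact Set.indicator_le_indicator (SimpleFunc.monotone_eapprox u hmn y)
  have hlim : ∀ y, Filter.Tendsto (fun n => f n y) Filter.atTop (nhds (u y)) := by
    intro y
    refine (SimpleFunc.tendsto_eapprox hu y).congr' ?_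
    filter_upwards [Filter.eventually_ge_atTop (spanningSetsIndex ν y)] with n hn
    rw [hfa, Set.indicator_of_mem]
    exact monotone_spanningSets ν hn (mem_spanningSetsIndex ν y)
  have hsupp : ∀ n, ν (Function.support (f n)) < ∞ := by
    intro n
    refine (measure_mono fun y hy => ?_).trans_lt (measure_spanningSets_lt_top ν n)
    by_contra h
    exact hy (by rw [hfa, Set.indicator_of_notMem h])
  have hL : Filter.Tendsto (fun n => ∫⁻ ω, expNeg (∫⁻ y, f n y ∂(N ω)) ∂P) Filter.atTop
      (nhds (∫⁻ ω, expNeg (∫⁻ y, u y ∂(N ω)) ∂P)) := by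
    refine tendsto_lintegral_of_dominated_convergence (fun _ => 1) (fun n => ?_) (fun n => ?_)
      (by simp) (Filter.Eventually.of_forall fun ω => ?_)
    · exact measurable_expNeg.comp ((Measure.measurable_lintegral (f n).measurable).comp hNm)
    · exact Filter.Eventually.of_forall fun ω => expNeg_le_one _
    · refine (continuous_expNeg.tendsto _).comp ?_
      exact lintegral_tendsto_of_tendsto_of_monotone (fun n => (f n).measurable.aemeasurable)
        (Filter.Eventually.of_forall hmono) (Filter.Eventually.of_forall hlim)
  have hR : Filter.Tendsto (fun n => expNeg (∫⁻ y, (1 - expNeg (f n y)) ∂ν)) Filter.atTop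
      (nhds (expNeg (∫⁻ y, (1 - expNeg (u y)) ∂ν))) := by
    refine (continuous_expNeg.tendsto _).comp ?_
    refine lintegral_tendsto_of_tendsto_of_monotone
      (fun n => (measurable_const.sub (measurable_expNeg.comp (f n).measurable)).aemeasurable)
      (Filter.Eventually.of_forall fun y m n hmn => ?_) (Filter.Eventually.of_forall fun y => ?_)
    · exact tsub_le_tsub_left (antitone_expNeg (hmono y hmn)) _
    · exact ENNReal.Tendsto.sub tendsto_const_nhds ((continuous_expNeg.tendsto _).comp (hlim y))
        (Or.inl ENNReal.one_ne_top)
  simp_rw [hN.lintegral_expNeg_simpleFunc hNm (f _) (hsupp _)] at hL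
  exact tendsto_nhds_unique hL hR

end IsPoissonPointProcess

end Laplace

lemma lintegral_countingMeasure {ι E : Type*} [MeasurableSpace E] (p : ι → E) {f : E → ℝ≥0∞}
    (hf : Measurable f) : ∫⁻ y, f y ∂(countingMeasure p) = ∑' i, f (p i) := by
  rw [countingMeasure, lintegral_sum_measure]
  exact tsum_congr fun i => lintegral_dirac' _ hf

lemma measurable_countingMeasure {Ω E : Type*} [MeasurableSpace Ω] [MeasurableSpace E]
    {X : ℕ → Ω → E} (hX : ∀ i, Measurable (X i)) :
    Measurable fun ω => countingMeasure fun i => X i ω := by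
  refine Measure.measurable_of_measurable_coe _ fun s hs => ?_
  simp only [countingMeasure, Measure.sum_apply _ hs]
  exact Measurable.tsum fun i =>
    (Measure.measurable_coe hs).comp (Measure.measurable_dirac.comp (hX i))

/-! ### Independent marking. -/

section Marking

variable {Ω E F : Type*} [MeasurableSpace Ω] [MeasurableSpace E] [MeasurableSpace F]
  {P : Measure Ω} [IsProbabilityMeasure P] {ν : Measure E} [SigmaFinite ν]
  {X : ℕ → Ω → E} {μ : Measure F} {h : ℕ → Ω → F}

/-- With the positions frozen by Fubini, the marks are still i.i.d. with law `μ`, so each factor can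
be averaged separately. -/
lemma lintegral_prod_marks (hXm : ∀ i, Measurable (X i)) (hhm : ∀ i, Measurable (h i))
    (hlaw : ∀ i, HasLaw (h i) μ P) (hindep : iIndepFun h P)
    (hXh : IndepFun (fun ω i => X i ω) (fun ω i => h i ω) P)
    {v : E × F → ℝ≥0∞} (hv : Measurable v) (n : ℕ) :
    ∫⁻ ω, ∏ i ∈ Finset.range n, v (X i ω, h i ω) ∂P =
      ∫⁻ ω, ∏ i ∈ Finset.range n, ∫⁻ g, v (X i ω, g) ∂μ ∂P := by
  have hXm' : Measurable fun ω i => X i ω := measurable_pi_lambda _ hXm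
  have hhm' : Measurable fun ω i => h i ω := measurable_pi_lambda _ hhm
  have hW : Measurable fun p : (ℕ → E) × (ℕ → F) => ∏ i ∈ Finset.range n, v (p.1 i, p.2 i) := by
    refine Finset.measurable_fun_prod _ fun i _ => hv.comp ?_
    fun_prop
  have hprod := (indepFun_iff_map_prod_eq_prod_map_map hXm'.aemeasurable hhm'.aemeasurable).1 hXh
  have : IsProbabilityMeasure (P.map fun ω i => h i ω) :=
    Measure.isProbabilityMeasure_map hhm'.aemeasurable
  calc ∫⁻ ω, ∏ i ∈ Finset.range n, v (X i ω, h i ω) ∂P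
      = ∫⁻ p, ∏ i ∈ Finset.range n, v (p.1 i, p.2 i)
          ∂(P.map fun ω => ((fun i => X i ω), (fun i => h i ω))) := by
        rw [lintegral_map hW (hXm'.prodMk hhm')]
    _ = ∫⁻ xs, ∫⁻ ω, ∏ i ∈ Finset.range n, v (xs i, h i ω) ∂P ∂(P.map fun ω i => X i ω) := by
        rw [hprod, lintegral_prod _ hW.aemeasurable]
        refine lintegral_congr fun xs => ?_
        have hW' := hW.comp (measurable_prodMk_left (x := xs))
        exact lintegral_map hW' hhm'
    _ = ∫⁻ xs, ∏ i ∈ Finset.range n, ∫⁻ g, v (xs i, g) ∂μ ∂(P.map fun ω i => X i ω) := by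
        refine lintegral_congr fun xs => ?_
        have hvi : ∀ i, Measurable fun g => v (xs i, g) := fun i => hv.comp measurable_prodMk_left
        rw [lintegral_prod_eq_prod_lintegral_of_indepFun _ (fun i ω => v (xs i, h i ω))
          (hindep.comp (fun i g => v (xs i, g)) hvi) fun i => (hvi i).comp (hhm i)]
        exact Finset.prod_congr rfl fun i _ => (hlaw i).lintegral_comp (hvi i).aemeasurable
    _ = ∫⁻ ω, ∏ i ∈ Finset.range n, ∫⁻ g, v (X i ω, g) ∂μ ∂P := by
        have : IsProbabilityMeasure μ := (hlaw 0).isProbabilityMeasure_iff.1 inferInstance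
        rw [lintegral_map _ hXm']
        exact Finset.measurable_fun_prod _ fun i _ =>
          hv.lintegral_prod_right'.comp (measurable_pi_apply i)

/-- The Laplace functional of an independently marked Poisson point process. -/
theorem IsPoissonPointProcess.lintegral_expNeg_marked
    (hX : IsPoissonPointProcess (fun ω => countingMeasure fun i => X i ω) ν P)
    (hXm : ∀ i, Measurable (X i)) (hhm : ∀ i, Measurable (h i))
    (hlaw : ∀ i, HasLaw (h i) μ P) (hindep : iIndepFun h P)
    (hXh : IndepFun (fun ω i => X i ω) (fun ω i => h i ω) P)
    {u : E × F → ℝ≥0∞} (hu : Measurable u) :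
    ∫⁻ ω, expNeg (∑' i, u (X i ω, h i ω)) ∂P =
      expNeg (∫⁻ p, (1 - expNeg (u p)) ∂(ν.prod μ)) := by
  have : IsProbabilityMeasure μ := (hlaw 0).isProbabilityMeasure_iff.1 inferInstance
  have hv : Measurable fun p => expNeg (u p) := measurable_expNeg.comp hu
  -- Chosen so that `e^{-U(y)}` is the mark average of `e^{-u(y, g)}`: the marked functional at `u`
  -- becomes the unmarked one at `U`. The value `∞` occurs where the average vanishes.
  let U : E → ℝ≥0∞ := fun y => negLog (∫⁻ g, expNeg (u (y, g)) ∂μ)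
  have hU : Measurable U := measurable_negLog.comp hv.lintegral_prod_right'
  have hexpU : ∀ y, expNeg (U y) = ∫⁻ g, expNeg (u (y, g)) ∂μ := fun y => by
    refine expNeg_negLog ((lintegral_mono fun g => expNeg_le_one _).trans ?_)
    simp
  have hlim : ∀ f : ℕ → Ω → ℝ≥0∞, (∀ i, Measurable (f i)) →
      Filter.Tendsto (fun n => ∫⁻ ω, ∏ i ∈ Finset.range n, expNeg (f i ω) ∂P) Filter.atTop
        (nhds (∫⁻ ω, expNeg (∑' i, f i ω) ∂P)) := by
    intro f hf
    simp_rw [← expNeg_sum]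
    refine tendsto_lintegral_of_dominated_convergence (fun _ => 1) (fun n => ?_) (fun n => ?_)
      (by simp) (Filter.Eventually.of_forall fun ω => ?_)
    · exact measurable_expNeg.comp (Finset.measurable_fun_sum _ fun i _ => hf i)
    · exact Filter.Eventually.of_forall fun ω => expNeg_le_one _
    · exact (continuous_expNeg.tendsto _).comp (ENNReal.tendsto_nat_tsum _)
  have h1 := hlim (fun i ω => u (X i ω, h i ω)) fun i => hu.comp ((hXm i).prodMk (hhm i))
  have h2 := hlim (fun i ω => U (X i ω)) fun i => hU.comp (hXm i)
  simp_rw [lintegral_prod_marks hXm hhm hlaw hindep hXh hv] at h1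
  simp_rw [hexpU] at h2
  rw [tendsto_nhds_unique h1 h2]
  have h3 := hX.lintegral_expNeg (measurable_countingMeasure hXm) hU
  simp_rw [lintegral_countingMeasure _ hU] at h3
  have hv' : Measurable fun p => 1 - expNeg (u p) := measurable_const.sub hv
  rw [h3, lintegral_prod _ hv'.aemeasurable]
  congr 1
  refine lintegral_congr fun y => ?_
  have hvy : Measurable fun g => expNeg (u (y, g)) := hv.comp measurable_prodMk_left
  rw [hexpU, lintegral_sub hvy]
  · simp
  · refine ne_top_of_le_ne_top ENNReal.one_ne_top
      ((lintegral_mono fun g => expNeg_le_one _).trans ?_)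
    simp
  · exact Filter.Eventually.of_forall fun g => expNeg_le_one _

end Marking

/-! ### Laplace transforms determine finite measures on `[0, ∞]ᵏ`. -/

section Uniqueness

/-- The functions `a ↦ e^{-a j}` are bounded, continuous (also at `∞`) and separate points, so the
algebra they generate determines a finite measure. It is spanned by their monomials, which explains
why natural exponents `c` suffice. -/
lemma ext_of_lintegral_expNeg {k : ℕ} {μ ν : Measure (Fin k → ℝ≥0∞)} [IsFiniteMeasure μ]
    [IsFiniteMeasure ν]
    (h : ∀ c : Fin k → ℕ, ∫⁻ a, expNeg (∑ j, c j * a j) ∂μ = ∫⁻ a, expNeg (∑ j, c j * a j) ∂ν) :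
    μ = ν := by
  let e : Fin k → BoundedContinuousFunction (Fin k → ℝ≥0∞) ℝ := fun j =>
    BoundedContinuousFunction.mkOfCompact
      ⟨fun a => (expNeg (a j)).toReal, by
        refine continuous_iff_continuousAt.2 fun a => ?_
        exact (ENNReal.tendsto_toReal (expNeg_ne_top _)).comp
          ((continuous_expNeg.comp (continuous_apply j)).tendsto a)⟩
  have he : ∀ j a, e j a = (expNeg (a j)).toReal := fun _ _ => rfl
  let A : StarSubalgebra ℝ (BoundedContinuousFunction (Fin k → ℝ≥0∞) ℝ) :=
    { Algebra.adjoin ℝ (Set.range e) with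
      star_mem' := fun {a} ha => by
        have : star a = a := by ext; simp
        rwa [this] }
  have hA : ∀ g, g ∈ A ↔ g ∈ Algebra.adjoin ℝ (Set.range e) := fun g => Iff.rfl
  refine ext_of_forall_mem_subalgebra_integral_eq_of_polish (𝕜 := ℝ) (A := A) ?_ fun g hg => ?_
  · intro a b hab
    obtain ⟨j, hj⟩ := Function.ne_iff.1 hab
    refine ⟨_, ⟨_, ⟨e j, (hA _).2 (Algebra.subset_adjoin ⟨j, rfl⟩), rfl⟩, rfl⟩, ?_⟩
    intro heq
    have : (expNeg (a j)).toReal = (expNeg (b j)).toReal := heq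
    rw [ENNReal.toReal_eq_toReal_iff' (expNeg_ne_top _) (expNeg_ne_top _)] at this
    exact hj (expNeg_injective this)
  · rw [hA, ← Subalgebra.mem_toSubmodule, Algebra.adjoin_eq_span] at hg
    induction hg using Submodule.span_induction with
    | mem g hg =>
      have : ∃ c : Fin k → ℕ, ∀ a, g a = (expNeg (∑ j, c j * a j)).toReal := by
        induction hg using Submonoid.closure_induction with
        | mem g hg =>
          obtain ⟨j, rfl⟩ := hg
          refine ⟨Pi.single j 1, fun a => ?_⟩
          rw [he, Finset.sum_eq_single j (by intro i _ hi; simp [hi]) (by simp)]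
          simp
        | one => exact ⟨0, fun a => by simp⟩
        | mul g₁ g₂ _ _ h₁ h₂ =>
          obtain ⟨c₁, h₁⟩ := h₁
          obtain ⟨c₂, h₂⟩ := h₂
          refine ⟨c₁ + c₂, fun a => ?_⟩
          rw [BoundedContinuousFunction.mul_apply, h₁, h₂, ← ENNReal.toReal_mul, ← expNeg_add,
            ← Finset.sum_add_distrib]
          simp [add_mul]
      obtain ⟨c, hc⟩ := this
      have hm : Measurable fun a : Fin k → ℝ≥0∞ => expNeg (∑ j, c j * a j) :=
        measurable_expNeg.comp (by fun_prop)
      simp_rw [hc]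
      rw [integral_toReal hm.aemeasurable (Filter.Eventually.of_forall fun a =>
          (expNeg_ne_top _).lt_top),
        integral_toReal hm.aemeasurable (Filter.Eventually.of_forall fun a =>
          (expNeg_ne_top _).lt_top), h c]
    | zero => simp
    | add g₁ g₂ _ _ h₁ h₂ =>
      simp only [BoundedContinuousFunction.coe_add, Pi.add_apply]
      rw [integral_add (g₁.integrable _) (g₂.integrable _),
        integral_add (g₁.integrable _) (g₂.integrable _), h₁, h₂]
    | smul c g _ h =>
      simp only [BoundedContinuousFunction.coe_smul]
      rw [integral_smul, integral_smul, h]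

end Uniqueness

/-! ### From the Laplace functional back to the Poisson property. -/

section Characterization

lemma one_sub_expNeg_sum_indicator {E : Type*} {k : ℕ} {B : Fin k → Set E}
    (hd : Pairwise fun i j => Disjoint (B i) (B j)) (c : Fin k → ℝ≥0∞) (y : E) :
    1 - expNeg (∑ j, (B j).indicator (fun _ => c j) y) =
      ∑ j, (B j).indicator (fun _ => 1 - expNeg (c j)) y := by
  by_cases hy : ∃ i, y ∈ B i
  · obtain ⟨i, hi⟩ := hy
    have hn : ∀ j, j ≠ i → y ∉ B j := fun j hj hyj => Set.disjoint_left.1 (hd hj) hyj hi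
    rw [Finset.sum_eq_single i (fun j _ hj => by simp [hn j hj]) (by simp),
      Finset.sum_eq_single i (fun j _ hj => by simp [hn j hj]) (by simp)]
    simp [hi]
  · push Not at hy
    simp [hy]

variable {Ω E : Type*} [MeasurableSpace Ω] [MeasurableSpace E] {P : Measure Ω}
  [IsProbabilityMeasure P] {N : Ω → Measure E} {ν : Measure E}

/-- The test function `∑ c j 1_{B j}` turns the functional into the Laplace transform of the vector
of counts. As the `B j` are disjoint, it is a product of Poisson transforms. -/
lemma map_count_eq_pi (hNm : Measurable N)
    (hL : ∀ u : E → ℝ≥0∞, Measurable u →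
      ∫⁻ ω, expNeg (∫⁻ y, u y ∂(N ω)) ∂P = expNeg (∫⁻ y, (1 - expNeg (u y)) ∂ν))
    {k : ℕ} {B : Fin k → Set E} (hB : ∀ j, MeasurableSet (B j)) (hB' : ∀ j, ν (B j) < ∞)
    (hd : Pairwise fun i j => Disjoint (B i) (B j)) :
    P.map (fun ω j => N ω (B j)) =
      Measure.pi fun j => (poissonMeasure (ν (B j)).toNNReal).map (fun k : ℕ => (k : ℝ≥0∞)) := by
  have hm : Measurable fun ω j => N ω (B j) :=
    measurable_pi_lambda _ fun j => (Measure.measurable_coe (hB j)).comp hNm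
  have : IsProbabilityMeasure (P.map fun ω j => N ω (B j)) :=
    Measure.isProbabilityMeasure_map hm.aemeasurable
  have (j : Fin k) : IsProbabilityMeasure
      ((poissonMeasure (ν (B j)).toNNReal).map (fun k : ℕ => (k : ℝ≥0∞))) :=
    Measure.isProbabilityMeasure_map (by fun_prop)
  refine ext_of_lintegral_expNeg fun c => ?_
  have hu := hL (fun y => ∑ j, (B j).indicator (fun _ => (c j : ℝ≥0∞)) y)
    (Finset.measurable_fun_sum _ fun j _ => measurable_const.indicator (hB j))
  have hI : ∀ (M : Measure E) (c : Fin k → ℝ≥0∞),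
      ∫⁻ y, ∑ j, (B j).indicator (fun _ => c j) y ∂M = ∑ j, c j * M (B j) := by
    intro M c
    rw [lintegral_finsetSum _ fun j _ => measurable_const.indicator (hB j)]
    simp_rw [lintegral_indicator_const (hB _)]
  simp_rw [one_sub_expNeg_sum_indicator hd, hI] at hu
  have hf : Measurable fun a : Fin k → ℝ≥0∞ => expNeg (∑ j, c j * a j) :=
    measurable_expNeg.comp (by fun_prop)
  have hf' : ∀ j, Measurable fun a : ℝ≥0∞ => expNeg (c j * a) := fun j =>
    measurable_expNeg.comp (by fun_prop)
  rw [lintegral_map hf hm, hu]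
  simp_rw [expNeg_sum]
  rw [lintegral_prod_eq_prod_lintegral_of_indepFun _ _
    (iIndepFun_pi fun j => (hf' j).aemeasurable) fun j => (hf' j).comp (measurable_pi_apply j)]
  refine Finset.prod_congr rfl fun j _ => ?_
  refine Eq.trans ?_ ((measurePreserving_eval (fun j => (poissonMeasure (ν (B j)).toNNReal).map
    (fun k : ℕ => (k : ℝ≥0∞))) j).lintegral_comp (hf' j)).symm
  rw [lintegral_expNeg_mul_poissonMeasure, ENNReal.coe_toNNReal (hB' j).ne]

/-- A random measure with the Laplace functional of a Poisson point process is one. -/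
theorem IsPoissonPointProcess.of_lintegral_expNeg (hNm : Measurable N)
    (hL : ∀ u : E → ℝ≥0∞, Measurable u →
      ∫⁻ ω, expNeg (∫⁻ y, u y ∂(N ω)) ∂P = expNeg (∫⁻ y, (1 - expNeg (u y)) ∂ν)) :
    IsPoissonPointProcess N ν P := by
  have hm : ∀ B : Set E, MeasurableSet B → Measurable fun ω => N ω B := fun B hB =>
    (Measure.measurable_coe hB).comp hNm
  have hone : ∀ B : Set E, MeasurableSet B → ν B < ∞ → P.map (fun ω => N ω B) =
      (poissonMeasure (ν B).toNNReal).map (fun k : ℕ => (k : ℝ≥0∞)) := by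
    intro B hB hB'
    have (j : Fin 1) : IsProbabilityMeasure
        ((poissonMeasure (ν B).toNNReal).map (fun k : ℕ => (k : ℝ≥0∞))) :=
      Measure.isProbabilityMeasure_map (by fun_prop)
    have h := congrArg (Measure.map fun a => a 0)
      (map_count_eq_pi hNm hL (B := fun _ : Fin 1 => B) (fun _ => hB) (fun _ => hB')
        fun i j hij => (hij (Subsingleton.elim i j)).elim)
    rw [Measure.map_map (by fun_prop) (measurable_pi_lambda _ fun _ => hm B hB)] at h
    exact h.trans (measurePreserving_eval _ 0).map_eq
  refine ⟨fun B hB hB' => ⟨(hm B hB).aemeasurable, hone B hB hB'⟩, fun k B hB hB' hd => ?_⟩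
  rw [iIndepFun_iff_map_fun_eq_pi_map fun j => (hm _ (hB j)).aemeasurable,
    map_count_eq_pi hNm hL hB hB' hd]
  congr 1
  ext1 j
  exact (hone _ (hB j) (hB' j)).symm

end Characterization

/-- Differentiability is asked only inside the interval because `t ^ (2 / α - 1)` blows up at `0`;
nonnegativity supplies the integrability. -/
lemma lintegral_Ioc_ofReal_deriv {G g : ℝ → ℝ} {b : ℝ} (hb : 0 ≤ b)
    (hc : ContinuousOn G (Set.Icc 0 b)) (hd : ∀ t ∈ Set.Ioo 0 b, HasDerivAt G (g t) t)
    (hg : ∀ t, 0 < t → 0 ≤ g t) :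
    ∫⁻ t in Set.Ioc 0 b, ENNReal.ofReal (g t) = ENNReal.ofReal (G b - G 0) := by
  have hint : IntegrableOn g (Set.Ioc 0 b) :=
    intervalIntegral.integrableOn_deriv_of_nonneg hc hd fun t ht => hg t ht.1
  rw [← ofReal_integral_eq_lintegral_ofReal hint, ← intervalIntegral.integral_of_le hb,
    intervalIntegral.integral_eq_sub_of_hasDerivAt_of_le hb hc hd
      ((intervalIntegrable_iff_integrableOn_Ioc_of_le hb).2 hint)]
  exact (ae_restrict_iff' measurableSet_Ioc).2 (Filter.Eventually.of_forall fun t ht => hg t ht.1)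

/-! ### Area of a planar sector. -/

section Sector

lemma toIcoMod_arg (c : ℂ) : toIcoMod Real.two_pi_pos 0 c.arg =
    if 0 ≤ c.arg then c.arg else c.arg + 2 * Real.pi := by
  have h1 := c.neg_pi_lt_arg
  have h2 := c.arg_le_pi
  have h3 := Real.pi_pos
  split_ifs with h
  · exact (toIcoMod_eq_self _).2 ⟨h, by linarith⟩
  · rw [← toIcoMod_add_right]
    push Not at h
    exact (toIcoMod_eq_self _).2 ⟨by linarith, by linarith⟩

lemma measurable_toIcoMod_arg : Measurable fun c : ℂ => toIcoMod Real.two_pi_pos 0 c.arg := by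
  simp_rw [toIcoMod_arg]
  exact Measurable.ite (measurableSet_le measurable_const Complex.measurable_arg)
    Complex.measurable_arg (Complex.measurable_arg.add_const _)

lemma measurableSet_complex_sector (φ R : ℝ) :
    MeasurableSet {c : ℂ | toIcoMod Real.two_pi_pos 0 c.arg ≤ φ ∧ ‖c‖ ≤ R} :=
  (measurableSet_le measurable_toIcoMod_arg measurable_const).inter
    (measurableSet_le measurable_norm measurable_const)

/-- The identification of the Euclidean plane with `ℂ`. -/
noncomputable def planeToComplex (v : EuclideanSpace ℝ (Fin 2)) : ℂ := ⟨v 0, v 1⟩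

lemma norm_planeToComplex (v : EuclideanSpace ℝ (Fin 2)) : ‖planeToComplex v‖ = ‖v‖ := by
  rw [EuclideanSpace.norm_eq, Complex.norm_eq_sqrt_sq_add_sq]
  simp [planeToComplex]

lemma measurePreserving_planeToComplex : MeasurePreserving planeToComplex := by
  have h := (Complex.volume_preserving_equiv_pi.symm).comp (PiLp.volume_preserving_ofLp (Fin 2))
  convert! h using 1
  ext v
  simp [planeToComplex, Complex.measurableEquivPi_symm_apply, Complex.ext_iff]

lemma measurable_directionAngle : Measurable directionAngle :=
  measurable_toIcoMod_arg.comp measurePreserving_planeToComplex.measurable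

lemma volume_angles {φ : ℝ} (hφ : 0 < φ) (hφ' : φ ≤ 2 * Real.pi) :
    volume {θ : ℝ | θ ∈ Set.Ioo (-Real.pi) Real.pi ∧
      (if 0 ≤ θ then θ else θ + 2 * Real.pi) ≤ φ} = ENNReal.ofReal φ := by
  have hpi := Real.pi_pos
  rcases lt_or_ge φ Real.pi with h | h
  · have : {θ : ℝ | θ ∈ Set.Ioo (-Real.pi) Real.pi ∧
        (if 0 ≤ θ then θ else θ + 2 * Real.pi) ≤ φ} = Set.Icc 0 φ := by
      ext θ
      simp only [Set.mem_ofPred_eq, Set.mem_Ioo, Set.mem_Icc]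
      constructor
      · rintro ⟨⟨h1, h2⟩, h3⟩
        split_ifs at h3 with h4
        · exact ⟨h4, h3⟩
        · linarith
      · rintro ⟨h1, h2⟩
        rw [if_pos h1]
        exact ⟨⟨by linarith, by linarith⟩, h2⟩
    rw [this, Real.volume_Icc, sub_zero]
  · have : {θ : ℝ | θ ∈ Set.Ioo (-Real.pi) Real.pi ∧
        (if 0 ≤ θ then θ else θ + 2 * Real.pi) ≤ φ} =
        Set.Ico 0 Real.pi ∪ (Set.Ioo (-Real.pi) 0 ∩ Set.Iic (φ - 2 * Real.pi)) := by
      ext θ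
      simp only [Set.mem_ofPred_eq, Set.mem_Ioo, Set.mem_union, Set.mem_Ico, Set.mem_inter_iff,
        Set.mem_Iic]
      constructor
      · rintro ⟨⟨h1, h2⟩, h3⟩
        split_ifs at h3 with h4
        · exact Or.inl ⟨h4, h2⟩
        · exact Or.inr ⟨⟨h1, lt_of_not_ge h4⟩, by linarith⟩
      · rintro (⟨h1, h2⟩ | ⟨⟨h1, h2⟩, h3⟩)
        · rw [if_pos h1]
          exact ⟨⟨by linarith, h2⟩, by linarith⟩
        · rw [if_neg (not_le.2 h2)]
          exact ⟨⟨h1, by linarith⟩, by linarith⟩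
    have hvol : volume (Set.Ioo (-Real.pi) 0 ∩ Set.Iic (φ - 2 * Real.pi)) =
        ENNReal.ofReal (φ - Real.pi) := by
      -- For `φ = 2π` the endpoint `0` is missing; adding this null point makes the set `(-π, φ -
      -- 2π]` in every case.
      have hae : (Set.Ioo (-Real.pi) 0 ∩ Set.Iic (φ - 2 * Real.pi) : Set ℝ) =ᵐ[volume]
          (Set.Ioc (-Real.pi) 0 ∩ Set.Iic (φ - 2 * Real.pi) : Set ℝ) :=
        Ioo_ae_eq_Ioc.inter (Filter.EventuallyEq.refl _ _)
      rw [measure_congr hae, Set.Ioc_inter_Iic,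
        min_eq_right (by linarith), Real.volume_Ioc]
      congr 1; ring
    rw [this, measure_union _ (measurableSet_Ioo.inter measurableSet_Iic), hvol, Real.volume_Ico,
      ← ENNReal.ofReal_add (by linarith) (by linarith)]
    · congr 1; ring
    · exact Set.disjoint_left.2 fun θ h1 h2 => not_lt.2 h1.1 h2.1.2

lemma volume_complex_sector {φ R : ℝ} (hφ : 0 < φ) (hφ' : φ ≤ 2 * Real.pi) (hR : 0 ≤ R) :
    volume {c : ℂ | toIcoMod Real.two_pi_pos 0 c.arg ≤ φ ∧ ‖c‖ ≤ R} =
      ENNReal.ofReal (φ / 2 * R ^ 2) := by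
  have hC := measurableSet_complex_sector φ R
  set C := {c : ℂ | toIcoMod Real.two_pi_pos 0 c.arg ≤ φ ∧ ‖c‖ ≤ R}
  set A := {θ : ℝ | θ ∈ Set.Ioo (-Real.pi) Real.pi ∧ (if 0 ≤ θ then θ else θ + 2 * Real.pi) ≤ φ}
  have hA : MeasurableSet A := by
    have h : Measurable fun θ : ℝ => if 0 ≤ θ then θ else θ + 2 * Real.pi :=
      Measurable.ite measurableSet_Ici measurable_id (measurable_id.add_const _)
    exact measurableSet_Ioo.inter (measurableSet_le h measurable_const)
  -- In polar coordinates the indicator, with its Jacobian `r`, splits into a radial and an angular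
  -- factor.
  have hpt : ∀ p ∈ polarCoord.target,
      ENNReal.ofReal p.1 • C.indicator 1 (Complex.polarCoord.symm p) =
      (Set.Iic R).indicator (fun r => ENNReal.ofReal r) p.1 * A.indicator 1 p.2 := by
    rintro ⟨r, θ⟩ hp
    rw [polarCoord_target] at hp
    obtain ⟨hr, hθ⟩ := hp
    simp only [Set.mem_Ioi] at hr
    have harg : (Complex.polarCoord.symm (r, θ)).arg = θ := by
      rw [Complex.polarCoord_symm_apply, Complex.ofReal_cos, Complex.ofReal_sin]
      exact Complex.arg_mul_cos_add_sin_mul_I hr ⟨hθ.1, hθ.2.le⟩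
    have hnorm : ‖Complex.polarCoord.symm (r, θ)‖ = r := by
      rw [Complex.norm_polarCoord_symm, abs_of_pos hr]
    have hmem : Complex.polarCoord.symm (r, θ) ∈ C ↔ r ∈ Set.Iic R ∧ θ ∈ A := by
      simp only [C, A, Set.mem_ofPred_eq, toIcoMod_arg, harg, hnorm, Set.mem_Iic]
      tauto
    simp only [Set.indicator, hmem]
    by_cases h1 : r ∈ Set.Iic R <;> by_cases h2 : θ ∈ A <;> simp [h1, h2]
  rw [← lintegral_indicator_one hC, ← Complex.lintegral_comp_polarCoord_symm,
    setLIntegral_congr_fun (polarCoord.open_target.measurableSet) hpt, polarCoord_target,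
    Measure.volume_eq_prod, ← Measure.prod_restrict,
    lintegral_prod_mul
      ((ENNReal.measurable_ofReal.indicator measurableSet_Iic).aemeasurable)
      ((measurable_one.indicator hA).aemeasurable),
    lintegral_indicator_one hA, Measure.restrict_apply hA, lintegral_indicator measurableSet_Iic,
    Measure.restrict_restrict measurableSet_Iic]
  have h1 : A ∩ Set.Ioo (-Real.pi) Real.pi = A := Set.inter_eq_left.2 fun θ h => h.1
  have h2 : Set.Iic R ∩ Set.Ioi 0 = Set.Ioc 0 R := by rw [Set.inter_comm, Set.Ioi_inter_Iic]
  rw [h1, h2, volume_angles hφ hφ', lintegral_Ioc_ofReal_deriv (G := fun r => r ^ 2 / 2) hR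
    (by fun_prop) (fun t _ => ?_) (fun t ht => ht.le), ← ENNReal.ofReal_mul' hφ.le]
  · congr 1; ring
  · have := (hasDerivAt_pow 2 t).div_const 2
    convert! this using 1
    simp

lemma volume_sector (x : EuclideanSpace ℝ (Fin 2)) {φ R : ℝ} (hφ : 0 < φ)
    (hφ' : φ ≤ 2 * Real.pi) (hR : 0 ≤ R) :
    volume {y | directionAngle (y - x) ≤ φ ∧ ‖y - x‖ ≤ R} = ENNReal.ofReal (φ / 2 * R ^ 2) := by
  rw [← volume_complex_sector hφ hφ' hR]
  have hm : MeasurePreserving fun y => planeToComplex (y - x) :=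
    measurePreserving_planeToComplex.comp (measurePreserving_sub_right volume x)
  rw [← hm.measure_preimage (measurableSet_complex_sector φ R).nullMeasurableSet]
  congr 1
  ext y
  simp only [Set.mem_ofPred_eq, Set.mem_preimage, norm_planeToComplex]
  rfl

end Sector

/-! ### The intensity measure on the power axis. -/

section Intensity

variable {lam α φ m : ℝ}

lemma cumulativeIntensity_zero (hα : 2 < α) : cumulativeIntensity lam α φ m 0 = 0 := by
  rw [cumulativeIntensity, Real.zero_rpow (by positivity), mul_zero]

lemma continuous_cumulativeIntensity (hα : 2 < α) :
    Continuous (cumulativeIntensity lam α φ m) := by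
  unfold cumulativeIntensity
  exact continuous_const.mul (Real.continuous_rpow_const (by positivity))

lemma hasDerivAt_cumulativeIntensity {t : ℝ} (ht : 0 < t) :
    HasDerivAt (cumulativeIntensity lam α φ m) (φ * lam / α * m * t ^ (2 / α - 1)) t := by
  have h := (Real.hasDerivAt_rpow_const (p := 2 / α) (Or.inl ht.ne')).const_mul (φ * lam / 2 * m)
  convert! h using 1
  ring

lemma cumulativeIntensity_nonneg (hlam : 0 < lam) (hφ : 0 < φ) (hm : 0 ≤ m) {z : ℝ} (hz : 0 ≤ z) :
    0 ≤ cumulativeIntensity lam α φ m z := by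
  unfold cumulativeIntensity; positivity

lemma powerAxisIntensity_apply_inter (A : Set ℝ) (hA : MeasurableSet A) :
    powerAxisIntensity lam α φ m A =
      ∫⁻ z in A ∩ Set.Ioi 0, ENNReal.ofReal (φ * lam / α * m * z ^ (2 / α - 1)) := by
  rw [powerAxisIntensity, withDensity_apply _ hA, Measure.restrict_restrict hA]

lemma setLIntegral_powerAxisDensity (hlam : 0 < lam) (hα : 2 < α) (hφ : 0 < φ) (hm : 0 ≤ m) {z : ℝ}
    (hz : 0 ≤ z) :
    ∫⁻ t in Set.Ioc 0 z, ENNReal.ofReal (φ * lam / α * m * t ^ (2 / α - 1)) =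
      ENNReal.ofReal (cumulativeIntensity lam α φ m z) := by
  rw [lintegral_Ioc_ofReal_deriv hz (continuous_cumulativeIntensity hα).continuousOn
    (fun t ht => hasDerivAt_cumulativeIntensity ht.1) (fun t ht => by positivity),
    cumulativeIntensity_zero hα, sub_zero]

lemma powerAxisIntensity_Iic (hlam : 0 < lam) (hα : 2 < α) (hφ : 0 < φ) (hm : 0 ≤ m) {z : ℝ}
    (hz : 0 ≤ z) : powerAxisIntensity lam α φ m (Set.Iic z) =
      ENNReal.ofReal (cumulativeIntensity lam α φ m z) := by
  rw [powerAxisIntensity_apply_inter _ measurableSet_Iic, Set.inter_comm, Set.Ioi_inter_Iic,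
    setLIntegral_powerAxisDensity hlam hα hφ hm hz]

lemma powerAxisIntensity_Icc (hlam : 0 < lam) (hα : 2 < α) (hφ : 0 < φ) (hm : 0 ≤ m) {z : ℝ}
    (hz : 0 ≤ z) : powerAxisIntensity lam α φ m (Set.Icc 0 z) =
      ENNReal.ofReal (cumulativeIntensity lam α φ m z) := by
  have : Set.Icc 0 z ∩ Set.Ioi 0 = Set.Ioc 0 z := by
    ext t
    simp only [Set.mem_inter_iff, Set.mem_Icc, Set.mem_Ioi, Set.mem_Ioc]
    constructor
    · rintro ⟨⟨_, h⟩, h'⟩; exact ⟨h', h⟩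
    · rintro ⟨h', h⟩; exact ⟨⟨h'.le, h⟩, h'⟩
  rw [powerAxisIntensity_apply_inter _ measurableSet_Icc, this,
    setLIntegral_powerAxisDensity hlam hα hφ hm hz]

lemma volume_sector_power_le (x : EuclideanSpace ℝ (Fin 2)) (hα : 2 < α) (hφ : 0 < φ)
    (hφ' : φ ≤ 2 * Real.pi) {g z : ℝ} (hg : 0 < g) (hz : 0 ≤ z) :
    volume {y | directionAngle (y - x) ≤ φ ∧ ‖y - x‖ ^ α / g ≤ z} =
      ENNReal.ofReal (φ / 2 * z ^ (2 / α) * g ^ (2 / α)) := by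
  have h1 : ∀ y, ‖y - x‖ ^ α / g ≤ z ↔ ‖y - x‖ ≤ (z * g) ^ α⁻¹ := fun y => by
    rw [div_le_iff₀ hg, Real.le_rpow_inv_iff_of_pos (norm_nonneg _) (by positivity) (by linarith)]
  simp_rw [h1]
  rw [volume_sector x hφ hφ' (by positivity), ← Real.rpow_natCast,
    ← Real.rpow_mul (by positivity), Real.mul_rpow hz hg.le]
  congr 1
  rw [show α⁻¹ * ((2 : ℕ) : ℝ) = 2 / α by push_cast; ring]
  ring

/-- The Poisson intensity of the marked nodes in the reception sector, pushed to the power axis. -/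
lemma map_restrict_sector (x : EuclideanSpace ℝ (Fin 2)) {μ : Measure ℝ}
    [IsProbabilityMeasure μ] (hlam : 0 < lam) (hα : 2 < α) (hφ : 0 < φ) (hφ' : φ ≤ 2 * Real.pi)
    (hpos : ∀ᵐ g ∂μ, 0 < g) (hint : Integrable (fun g => g ^ (2 / α)) μ) :
    (((ENNReal.ofReal lam • volume).prod μ).restrict
        {p : EuclideanSpace ℝ (Fin 2) × ℝ | directionAngle (p.1 - x) ≤ φ}).map
      (fun p => ‖p.1 - x‖ ^ α / p.2) =
    powerAxisIntensity lam α φ (∫ g, g ^ (2 / α) ∂μ) := by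
  set m := ∫ g, g ^ (2 / α) ∂μ
  have hm : 0 ≤ m := integral_nonneg_of_ae (hpos.mono fun g hg => (Real.rpow_pos_of_pos hg _).le)
  have hT : Measurable fun p : EuclideanSpace ℝ (Fin 2) × ℝ => ‖p.1 - x‖ ^ α / p.2 := by fun_prop
  have hS : MeasurableSet {p : EuclideanSpace ℝ (Fin 2) × ℝ | directionAngle (p.1 - x) ≤ φ} :=
    measurableSet_le (measurable_directionAngle.comp (by fun_prop)) measurable_const
  set κ := (((ENNReal.ofReal lam • volume).prod μ).restrict
        {p : EuclideanSpace ℝ (Fin 2) × ℝ | directionAngle (p.1 - x) ≤ φ}).map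
      (fun p => ‖p.1 - x‖ ^ α / p.2)
  have hIic : ∀ z, 0 ≤ z → κ (Set.Iic z) = ENNReal.ofReal (cumulativeIntensity lam α φ m z) := by
    intro z hz
    have hmeas : MeasurableSet {p : EuclideanSpace ℝ (Fin 2) × ℝ |
        directionAngle (p.1 - x) ≤ φ ∧ ‖p.1 - x‖ ^ α / p.2 ≤ z} :=
      hS.inter (measurableSet_le hT measurable_const)
    have hset : (fun p : EuclideanSpace ℝ (Fin 2) × ℝ => ‖p.1 - x‖ ^ α / p.2) ⁻¹' Set.Iic z ∩
        {p : EuclideanSpace ℝ (Fin 2) × ℝ | directionAngle (p.1 - x) ≤ φ} =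
        {p : EuclideanSpace ℝ (Fin 2) × ℝ |
          directionAngle (p.1 - x) ≤ φ ∧ ‖p.1 - x‖ ^ α / p.2 ≤ z} := by
      ext p
      simp only [Set.mem_inter_iff, Set.mem_preimage, Set.mem_Iic, Set.mem_ofPred_eq]
      tauto
    rw [Measure.map_apply hT measurableSet_Iic, Measure.restrict_apply (hT measurableSet_Iic),
      hset, Measure.prod_apply_symm hmeas]
    -- The slice at a fixed gain is a sector; integrating its measure over `g` produces the moment
    -- of order `2 / α`.
    have hinner : ∀ᵐ g ∂μ, (ENNReal.ofReal lam • volume) ((fun y => (y, g)) ⁻¹'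
        {p : EuclideanSpace ℝ (Fin 2) × ℝ |
          directionAngle (p.1 - x) ≤ φ ∧ ‖p.1 - x‖ ^ α / p.2 ≤ z}) =
        ENNReal.ofReal (φ * lam / 2 * z ^ (2 / α) * g ^ (2 / α)) := by
      filter_upwards [hpos] with g hg
      have := volume_sector_power_le x hα hφ hφ' hg hz
      rw [Measure.smul_apply, smul_eq_mul]
      refine (congrArg (ENNReal.ofReal lam * ·) this).trans ?_
      rw [← ENNReal.ofReal_mul hlam.le]
      congr 1; ring
    rw [lintegral_congr_ae hinner, ← ofReal_integral_eq_lintegral_ofReal (hint.const_mul _),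
      integral_const_mul]
    · congr 1
      rw [cumulativeIntensity]; ring
    · exact hpos.mono fun g hg => by positivity
  have heq : ∀ z, κ (Set.Iic z) = powerAxisIntensity lam α φ m (Set.Iic z) := by
    intro z
    rcases le_or_gt 0 z with hz | hz
    · rw [hIic z hz, powerAxisIntensity_Iic hlam hα hφ hm hz]
    -- Neither measure charges the nonpositive half-line, since `Λ₂(0) = 0`.
    · have h0 := hIic 0 le_rfl
      have h0' := powerAxisIntensity_Iic hlam hα hφ hm le_rfl
      rw [cumulativeIntensity_zero hα, ENNReal.ofReal_zero] at h0 h0'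
      rw [measure_mono_null (Set.Iic_subset_Iic.2 hz.le) h0,
        measure_mono_null (Set.Iic_subset_Iic.2 hz.le) h0']
  have hfin : ∀ z, κ (Set.Iic z) ≠ ∞ := fun z =>
    ne_top_of_le_ne_top (hIic (max z 0) (le_max_right _ _) ▸ ENNReal.ofReal_ne_top)
      (measure_mono (Set.Iic_subset_Iic.2 (le_max_left z 0)))
  refine Measure.ext_of_Ioc' _ _ (fun a b _ => ?_) fun a b hab => ?_
  · exact ne_top_of_le_ne_top (hfin b) (measure_mono Set.Ioc_subset_Iic_self)
  · rw [← Set.Iic_sdiff_Iic, measure_sdiff (Set.Iic_subset_Iic.2 hab.le)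
      measurableSet_Iic.nullMeasurableSet (hfin a), measure_sdiff (Set.Iic_subset_Iic.2 hab.le)
      measurableSet_Iic.nullMeasurableSet (heq a ▸ hfin a), heq, heq]

end Intensity

/-! ### The interferers as a point process on the power axis. -/

section PowerAxis

variable {α φ : ℝ} {x : EuclideanSpace ℝ (Fin 2)}

lemma lintegral_powerAxisProcess (X : ℕ → EuclideanSpace ℝ (Fin 2)) (h : ℕ → ℝ) {u : ℝ → ℝ≥0∞}
    (hu : Measurable u) :
    ∫⁻ z, u z ∂(powerAxisProcess α φ x X h) =
      ∑' i, {p : EuclideanSpace ℝ (Fin 2) × ℝ | directionAngle (p.1 - x) ≤ φ}.indicator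
        (fun p => u (‖p.1 - x‖ ^ α / p.2)) (X i, h i) := by
  rw [powerAxisProcess, lintegral_countingMeasure _ hu,
    tsum_subtype (interferers φ x X) fun i => u (‖X i - x‖ ^ α / h i)]
  refine tsum_congr fun i => ?_
  simp only [Set.indicator, interferers, Set.mem_ofPred_eq]
  congr

variable {Ω : Type*} [MeasurableSpace Ω] {P : Measure Ω} [IsProbabilityMeasure P]
  {X : ℕ → Ω → EuclideanSpace ℝ (Fin 2)} {h : ℕ → Ω → ℝ} {μh : Measure ℝ} {lam : ℝ}

lemma measurable_indicator_sector {u : ℝ → ℝ≥0∞} (hu : Measurable u) :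
    Measurable ({p : EuclideanSpace ℝ (Fin 2) × ℝ | directionAngle (p.1 - x) ≤ φ}.indicator
        fun p => u (‖p.1 - x‖ ^ α / p.2)) :=
  (hu.comp (by fun_prop)).indicator
    (measurableSet_le (measurable_directionAngle.comp (by fun_prop)) measurable_const)

lemma measurable_powerAxisProcess (hXm : ∀ i, Measurable (X i)) (hhm : ∀ i, Measurable (h i)) :
    Measurable fun ω => powerAxisProcess α φ x (fun i => X i ω) (fun i => h i ω) := by
  refine Measure.measurable_of_measurable_coe _ fun B hB => ?_
  have hu : Measurable (B.indicator (1 : ℝ → ℝ≥0∞)) := measurable_one.indicator hB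
  simp_rw [← lintegral_indicator_one hB, lintegral_powerAxisProcess _ _ hu]
  exact Measurable.tsum fun i =>
    (measurable_indicator_sector hu).comp ((hXm i).prodMk (hhm i))

/-- The Laplace functional of the point process of the interferers on the power axis. -/
theorem lintegral_expNeg_powerAxisProcess (hlam : 0 < lam) (hα : 2 < α) (hφ : 0 < φ)
    (hφ' : φ ≤ 2 * Real.pi) (hXm : ∀ i, Measurable (X i))
    (hX : IsPoissonPointProcess (fun ω => countingMeasure fun i => X i ω)
      (ENNReal.ofReal lam • volume) P)
    (hhm : ∀ i, Measurable (h i)) (hlaw : ∀ i, HasLaw (h i) μh P) (hindep : iIndepFun h P)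
    (hXh : IndepFun (fun ω i => X i ω) (fun ω i => h i ω) P)
    (hpos : ∀ᵐ g ∂μh, 0 < g) (hint : Integrable (fun g => g ^ (2 / α)) μh)
    {u : ℝ → ℝ≥0∞} (hu : Measurable u) :
    ∫⁻ ω, expNeg (∫⁻ z, u z ∂(powerAxisProcess α φ x (fun i => X i ω) (fun i => h i ω))) ∂P =
      expNeg (∫⁻ z, (1 - expNeg (u z)) ∂(powerAxisIntensity lam α φ (∫ g, g ^ (2 / α) ∂μh))) := by
  have : IsProbabilityMeasure μh := (hlaw 0).isProbabilityMeasure_iff.1 inferInstance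
  have : SigmaFinite (ENNReal.ofReal lam • (volume : Measure (EuclideanSpace ℝ (Fin 2)))) :=
    SMul.sigmaFinite lam.toNNReal
  have hS : MeasurableSet {p : EuclideanSpace ℝ (Fin 2) × ℝ | directionAngle (p.1 - x) ≤ φ} :=
    measurableSet_le (measurable_directionAngle.comp (by fun_prop)) measurable_const
  -- Nodes outside the sector carry the test value `0`, for which `1 - e⁻⁰ = 0`; the angular
  -- selection thus becomes a restriction of the intensity.
  simp_rw [lintegral_powerAxisProcess _ _ hu]
  rw [hX.lintegral_expNeg_marked hXm hhm hlaw hindep hXh (measurable_indicator_sector hu),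
    ← map_restrict_sector x hlam hα hφ hφ' hpos hint, lintegral_map _ (by fun_prop),
    ← lintegral_indicator hS]
  · congr 1
    refine lintegral_congr fun p => ?_
    by_cases hp : p ∈ {p : EuclideanSpace ℝ (Fin 2) × ℝ | directionAngle (p.1 - x) ≤ φ} <;>
      simp only [Set.indicator, hp, if_true, if_false, expNeg_zero, tsub_self]
  · exact measurable_const.sub (measurable_expNeg.comp hu)

end PowerAxis

/-! ### Ordering a locally finite family of positive reals. -/

section NthLargest

variable {ι : Type*} {S : Set ι} {a : ι → ℝ}

/-- The rank of the member `i` in the decreasing order of the family `a` over `S`. -/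
noncomputable def rankIn (S : Set ι) (a : ι → ℝ) (i : ι) : ℕ := {j | j ∈ S ∧ a i ≤ a j}.ncard

lemma rankIn_le_encard_iff (hpos : ∀ i ∈ S, 0 < a i)
    (hfin : ∀ t, 0 < t → {i | i ∈ S ∧ t ≤ a i}.Finite) {i : ι} (hi : i ∈ S) (t : ℝ) :
    (rankIn S a i : ℕ∞) ≤ {j | j ∈ S ∧ t ≤ a j}.encard ↔ t ≤ a i := by
  have hf := hfin _ (hpos i hi)
  rw [rankIn, hf.cast_ncard_eq]
  constructor
  · intro h
    by_contra! hlt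
    have hss : {j | j ∈ S ∧ t ≤ a j} ⊂ {j | j ∈ S ∧ a i ≤ a j} := by
      refine ⟨fun j hj => ⟨hj.1, hlt.le.trans hj.2⟩, fun hsub => ?_⟩
      exact absurd (hsub ⟨hi, le_rfl⟩ : i ∈ {j | j ∈ S ∧ t ≤ a j}).2 (not_le.2 hlt)
    exact absurd h (not_le.2 ((hf.subset hss.subset).encard_lt_encard hss))
  · exact fun h => Set.encard_le_encard fun j hj => ⟨hj.1, h.trans hj.2⟩

lemma nthLargest_eq (hpos : ∀ i ∈ S, 0 < a i)
    (hfin : ∀ t, 0 < t → {i | i ∈ S ∧ t ≤ a i}.Finite) {i : ι} (hi : i ∈ S) :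
    nthLargest S a (rankIn S a i) = a i := by
  have : {t : ℝ | (rankIn S a i : ℕ∞) ≤ {j | j ∈ S ∧ t ≤ a j}.encard} = Set.Iic (a i) := by
    ext t
    exact rankIn_le_encard_iff hpos hfin hi t
  rw [nthLargest, this, csSup_Iic]

lemma one_le_rankIn (hpos : ∀ i ∈ S, 0 < a i)
    (hfin : ∀ t, 0 < t → {i | i ∈ S ∧ t ≤ a i}.Finite) {i : ι} (hi : i ∈ S) :
    1 ≤ rankIn S a i :=
  (Set.ncard_pos (hfin _ (hpos i hi))).2 ⟨i, hi, le_rfl⟩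

/-- Take `n` members and the finite set `F` of all members at least as large as the smallest of
them. Ranks are injective on `F` and lie in `[1, |F|]`, so by counting they fill this interval,
which contains `n`. -/
lemma exists_rankIn_eq (hpos : ∀ i ∈ S, 0 < a i)
    (hfin : ∀ t, 0 < t → {i | i ∈ S ∧ t ≤ a i}.Finite) (hinj : Set.InjOn a S)
    (hinf : S.Infinite) {n : ℕ} (hn : 1 ≤ n) : ∃ i ∈ S, rankIn S a i = n := by
  classical
  obtain ⟨T, hTS, hTn⟩ := hinf.exists_subset_card_eq n
  obtain ⟨i₀, hi₀, hmin⟩ := T.exists_min_image a (Finset.card_pos.1 (by omega))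
  have hF := hfin (a i₀) (hpos i₀ (hTS hi₀))
  set F := hF.toFinset
  have hFmem : ∀ j, j ∈ F ↔ j ∈ S ∧ a i₀ ≤ a j := fun j => hF.mem_toFinset
  have hnF : n ≤ F.card := by
    rw [← hTn]
    exact Finset.card_le_card fun j hj => (hFmem j).2 ⟨hTS hj, hmin j hj⟩
  have hle : ∀ j ∈ F, rankIn S a j ≤ F.card := by
    intro j hj
    rw [rankIn, ← Set.ncard_coe_finset]
    refine Set.ncard_le_ncard (fun k hk => ?_) F.finite_toSet
    exact (hFmem k).2 ⟨hk.1, ((hFmem j).1 hj).2.trans hk.2⟩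
  have hinj' : Set.InjOn (rankIn S a) F := by
    intro i hi j hj hij
    have hi' := ((hFmem i).1 hi).1
    have hj' := ((hFmem j).1 hj).1
    exact hinj hi' hj' (by rw [← nthLargest_eq hpos hfin hi', hij, nthLargest_eq hpos hfin hj'])
  have himg : F.image (rankIn S a) = Finset.Icc 1 F.card := by
    refine Finset.eq_of_subset_of_card_le (fun r hr => ?_) ?_
    · obtain ⟨j, hj, rfl⟩ := Finset.mem_image.1 hr
      exact Finset.mem_Icc.2 ⟨one_le_rankIn hpos hfin ((hFmem j).1 hj).1, hle j hj⟩
    · rw [Finset.card_image_of_injOn hinj']; simp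
  obtain ⟨i, hi, hin⟩ := Finset.mem_image.1 (himg ▸ Finset.mem_Icc.2 ⟨hn, hnF⟩)
  exact ⟨i, ((hFmem i).1 hi).1, hin⟩

lemma strictAntiOn_nthLargest (hpos : ∀ i ∈ S, 0 < a i)
    (hfin : ∀ t, 0 < t → {i | i ∈ S ∧ t ≤ a i}.Finite) (hinj : Set.InjOn a S)
    (hinf : S.Infinite) : StrictAntiOn (nthLargest S a) (Set.Ici 1) := by
  intro m hm n hn hmn
  obtain ⟨i, hi, rfl⟩ := exists_rankIn_eq hpos hfin hinj hinf hm
  obtain ⟨j, hj, rfl⟩ := exists_rankIn_eq hpos hfin hinj hinf hn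
  rw [nthLargest_eq hpos hfin hi, nthLargest_eq hpos hfin hj]
  by_contra! h
  refine absurd hmn (not_lt.2 ?_)
  exact Set.ncard_le_ncard (fun k hk => ⟨hk.1, h.trans hk.2⟩) (hfin _ (hpos i hi))

lemma image_nthLargest (hpos : ∀ i ∈ S, 0 < a i)
    (hfin : ∀ t, 0 < t → {i | i ∈ S ∧ t ≤ a i}.Finite) (hinj : Set.InjOn a S)
    (hinf : S.Infinite) : nthLargest S a '' Set.Ici 1 = a '' S := by
  ext t
  constructor
  · rintro ⟨n, hn, rfl⟩
    obtain ⟨i, hi, rfl⟩ := exists_rankIn_eq hpos hfin hinj hinf hn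
    exact ⟨i, hi, (nthLargest_eq hpos hfin hi).symm⟩
  · rintro ⟨i, hi, rfl⟩
    exact ⟨_, one_le_rankIn hpos hfin hi, nthLargest_eq hpos hfin hi⟩

lemma nthLargest_pos (hpos : ∀ i ∈ S, 0 < a i)
    (hfin : ∀ t, 0 < t → {i | i ∈ S ∧ t ≤ a i}.Finite) (hinj : Set.InjOn a S)
    (hinf : S.Infinite) {n : ℕ} (hn : 1 ≤ n) : 0 < nthLargest S a n := by
  obtain ⟨i, hi, rfl⟩ := exists_rankIn_eq hpos hfin hinj hinf hn
  rw [nthLargest_eq hpos hfin hi]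
  exact hpos i hi

lemma le_nthLargest_iff (hpos : ∀ i ∈ S, 0 < a i)
    (hfin : ∀ t, 0 < t → {i | i ∈ S ∧ t ≤ a i}.Finite) (hinj : Set.InjOn a S)
    (hinf : S.Infinite) {n : ℕ} (hn : 1 ≤ n) (t : ℝ) :
    t ≤ nthLargest S a n ↔ (n : ℕ∞) ≤ {i | i ∈ S ∧ t ≤ a i}.encard := by
  obtain ⟨i, hi, rfl⟩ := exists_rankIn_eq hpos hfin hinj hinf hn
  rw [nthLargest_eq hpos hfin hi, rankIn_le_encard_iff hpos hfin hi]

end NthLargest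

/-! ### The Poisson tail and its derivative in the mean. -/

section PoissonTail

lemma poissonMeasure_Ici (r : ℝ≥0) (n : ℕ) :
    poissonMeasure r (Set.Ici n) =
      ENNReal.ofReal (1 - ∑ k ∈ Finset.range n, Real.exp (-r) * (r : ℝ) ^ k / k.factorial) := by
  have h1 : (Set.Ici n)ᶜ = ((Finset.range n : Finset ℕ) : Set ℕ) := by
    ext k; simp
  have h2 : poissonMeasure r ((Finset.range n : Finset ℕ) : Set ℕ) =
      ENNReal.ofReal (∑ k ∈ Finset.range n, Real.exp (-r) * (r : ℝ) ^ k / k.factorial) := by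
    rw [← sum_measure_singleton, ENNReal.ofReal_sum_of_nonneg fun k _ => by positivity]
    exact Finset.sum_congr rfl fun k _ => poissonMeasure_singleton r k
  rw [← compl_compl (Set.Ici n), h1, prob_compl_eq_one_sub (Finset.measurableSet _), h2,
    ENNReal.ofReal_sub _ (Finset.sum_nonneg fun k _ => by positivity), ENNReal.ofReal_one]

lemma hasDerivAt_poisson_sum (n : ℕ) (s : ℝ) :
    HasDerivAt (fun s : ℝ => ∑ k ∈ Finset.range (n + 1), Real.exp (-s) * s ^ k / k.factorial)
      (-(Real.exp (-s) * s ^ n / n.factorial)) s := by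
  have hexp : HasDerivAt (fun s : ℝ => Real.exp (-s)) (-Real.exp (-s)) s := by
    simpa using (hasDerivAt_neg s).exp
  induction n with
  | zero => simpa using hexp
  | succ n ih =>
    have h := ih.add ((hexp.mul (hasDerivAt_pow (n + 1) s)).div_const ((n + 1).factorial : ℝ))
    simp_rw [Finset.sum_range_succ _ (n + 1)]
    refine h.congr_deriv ?_
    rw [Nat.factorial_succ]
    have : (n.factorial : ℝ) ≠ 0 := by positivity
    have : ((n : ℝ) + 1) ≠ 0 := by positivity
    push_cast
    field_simp
    ring

end PoissonTail

/-! ### Counts of a Poisson process and absence of double points. -/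

section Simple

variable {Ω E : Type*} [MeasurableSpace Ω] [MeasurableSpace E] {P : Measure Ω}
  {N : Ω → Measure E} {ν : Measure E}

namespace IsPoissonPointProcess

lemma measure_le_count (hN : IsPoissonPointProcess N ν P) {B : Set E} (hB : MeasurableSet B)
    (hB' : ν B ≠ ∞) (n : ℕ) :
    P {ω | (n : ℝ≥0∞) ≤ N ω B} = ENNReal.ofReal
      (1 - ∑ k ∈ Finset.range n, Real.exp (-(ν B).toReal) * (ν B).toReal ^ k / k.factorial) := by
  have h := (hN.hasLaw_count B hB hB'.lt_top).measure_eq (p := fun a => (n : ℝ≥0∞) ≤ a)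
    measurableSet_Ici
  have h' := Measure.map_apply (μ := poissonMeasure (ν B).toNNReal)
    (f := fun k : ℕ => (k : ℝ≥0∞)) (by fun_prop) (measurableSet_Ici (a := (n : ℝ≥0∞)))
  have hpre : (fun k : ℕ => (k : ℝ≥0∞)) ⁻¹' Set.Ici (n : ℝ≥0∞) = Set.Ici n := by
    ext k; simp
  rw [hpre, poissonMeasure_Ici] at h'
  exact h.trans h'

lemma ae_count_ne_top (hN : IsPoissonPointProcess N ν P) {B : Set E} (hB : MeasurableSet B)
    (hB' : ν B ≠ ∞) : ∀ᵐ ω ∂P, N ω B ≠ ∞ := by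
  have hm : MeasurableSet {a : ℝ≥0∞ | a ≠ ∞} := (measurableSet_singleton ∞).compl
  rw [(hN.hasLaw_count B hB hB'.lt_top).ae_iff (p := fun a => a ≠ ∞) (measurableSet_setOfPred.1 hm),
    ae_map_iff (by fun_prop) hm]
  exact Filter.Eventually.of_forall fun k => ENNReal.natCast_ne_top k

lemma ae_count_eq_zero (hN : IsPoissonPointProcess N ν P) {B : Set E} (hB : MeasurableSet B)
    (hB' : ν B = 0) : ∀ᵐ ω ∂P, N ω B = 0 := by
  have hm : MeasurableSet {a : ℝ≥0∞ | a = 0} := measurableSet_singleton 0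
  rw [(hN.hasLaw_count B hB (by simp [hB'])).ae_iff (p := fun a => a = 0)
    (measurableSet_setOfPred.1 hm), ae_map_iff (by fun_prop) hm, hB', ae_iff]
  have h := poissonMeasure_Ici 0 1
  refine measure_mono_null (fun k hk => ?_) (h.trans (by simp))
  simpa [Nat.one_le_iff_ne_zero] using hk

/-- With `r = ν B` finite, `1 - e⁻ʳ (1 + r) ≤ 1 - (1 - r)(1 + r) = r²`. -/
lemma measure_two_le_count (hN : IsPoissonPointProcess N ν P) {B : Set E}
    (hB : MeasurableSet B) : P {ω | 2 ≤ N ω B} ≤ ν B ^ 2 := by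
  by_cases hB' : ν B = ∞
  · simp [hB']
  have h := hN.measure_le_count hB hB' 2
  rw [← ENNReal.ofReal_toReal hB']
  rw [Nat.cast_ofNat] at h
  rw [h, ← ENNReal.ofReal_pow ENNReal.toReal_nonneg]
  refine ENNReal.ofReal_le_ofReal ?_
  set r := (ν B).toReal
  have hr : 0 ≤ r := ENNReal.toReal_nonneg
  have he : 1 - r ≤ Real.exp (-r) := Real.one_sub_le_exp_neg r
  simp only [Finset.sum_range_succ, Finset.range_zero, Finset.sum_empty]
  norm_num
  nlinarith

/-- A double point in `D` puts two points into some cell `B l`, so the union bound gives outer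
probability at most `∑ ν (B l) ^ 2`. -/
lemma ae_count_singleton_lt_two (hN : IsPoissonPointProcess N ν P) {D : Set E}
    (hD : ∀ ε : ℝ≥0∞, 0 < ε → ∃ (K : ℕ) (B : ℕ → Set E), (∀ l, MeasurableSet (B l)) ∧
      (D ⊆ ⋃ l ∈ Finset.range K, B l) ∧ ∑ l ∈ Finset.range K, ν (B l) ^ 2 ≤ ε) :
    ∀ᵐ ω ∂P, ∀ z ∈ D, N ω {z} < 2 := by
  rw [ae_iff]
  refine le_antisymm (le_of_forall_gt_imp_ge_of_dense fun ε hε => ?_) zero_le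
  obtain ⟨K, B, hB, hDB, hsum⟩ := hD ε hε
  refine le_trans ?_ hsum
  refine le_trans ?_ (Finset.sum_le_sum fun l _ => hN.measure_two_le_count (hB l))
  refine le_trans (measure_mono fun ω hω => ?_) (measure_biUnion_finset_le _ _)
  simp only [Set.mem_ofPred_eq, not_forall, not_lt] at hω
  obtain ⟨z, hz, h2⟩ := hω
  obtain ⟨l, hl, hzl⟩ := Set.mem_iUnion₂.1 (hDB hz)
  exact Set.mem_iUnion₂.2 ⟨l, hl, h2.trans (measure_mono (Set.singleton_subset_iff.2 hzl))⟩

end IsPoissonPointProcess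

end Simple

/-! ### Inverting `Λ₂`, and the distribution function of the density. -/

section InverseIntensity

variable {lam α φ m : ℝ}

lemma cumulativeIntensity_lt_iff (hlam : 0 < lam) (hα : 2 < α) (hφ : 0 < φ) (hm : 0 < m)
    {y z : ℝ} (hy : 0 ≤ y) (hz : 0 ≤ z) :
    cumulativeIntensity lam α φ m y < cumulativeIntensity lam α φ m z ↔ y < z := by
  unfold cumulativeIntensity
  rw [mul_lt_mul_iff_right₀ (by positivity), Real.rpow_lt_rpow_iff hy hz (by positivity)]

lemma exists_cumulativeIntensity_eq (hlam : 0 < lam) (hα : 2 < α) (hφ : 0 < φ) (hm : 0 < m)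
    {t : ℝ} (ht : 0 ≤ t) : ∃ z, 0 ≤ z ∧ cumulativeIntensity lam α φ m z = t := by
  have hc : 0 < φ * lam / 2 * m := by positivity
  refine ⟨(t / (φ * lam / 2 * m)) ^ (α / 2), by positivity, ?_⟩
  rw [cumulativeIntensity, ← Real.rpow_mul (by positivity),
    show α / 2 * (2 / α) = 1 by field_simp, Real.rpow_one]
  field_simp

lemma powerAxisIntensity_univ (hlam : 0 < lam) (hα : 2 < α) (hφ : 0 < φ) (hm : 0 < m) :
    powerAxisIntensity lam α φ m Set.univ = ∞ := by
  refine ENNReal.eq_top_of_forall_nnreal_le fun r => ?_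
  obtain ⟨z, hz, hzr⟩ := exists_cumulativeIntensity_eq hlam hα hφ hm r.coe_nonneg
  refine le_trans (le_of_eq ?_) (measure_mono (Set.subset_univ (Set.Iic z)))
  rw [powerAxisIntensity_Iic hlam hα hφ hm.le hz, hzr, ENNReal.ofReal_coe_nnreal]

/-- Cut where `Λ₂` equals `l / n`: the `n M` cells have intensity `1 / n` each, so the squares sum
to `M / n`. -/
lemma exists_cover_powerAxisIntensity (hlam : 0 < lam) (hα : 2 < α) (hφ : 0 < φ) (hm : 0 < m)
    (M : ℕ) {ε : ℝ≥0∞} (hε : 0 < ε) : ∃ (K : ℕ) (B : ℕ → Set ℝ), (∀ l, MeasurableSet (B l)) ∧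
      ({z | 0 < z ∧ cumulativeIntensity lam α φ m z ≤ M} ⊆ ⋃ l ∈ Finset.range K, B l) ∧
      ∑ l ∈ Finset.range K, powerAxisIntensity lam α φ m (B l) ^ 2 ≤ ε := by
  obtain ⟨n, hn, hnε⟩ : ∃ n : ℕ, 0 < n ∧ ENNReal.ofReal (M / n) ≤ ε := by
    have h : Filter.Tendsto (fun n : ℕ => ENNReal.ofReal (M / n)) Filter.atTop (nhds 0) := by
      simpa using ENNReal.tendsto_ofReal (tendsto_const_div_atTop_nhds_zero_nat (M : ℝ))
    exact ((Filter.eventually_gt_atTop 0).and (h.eventually_le_const hε)).exists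
  have hn' : (0 : ℝ) < n := by exact_mod_cast hn
  choose a ha hat using fun l : ℕ =>
    exists_cumulativeIntensity_eq hlam hα hφ hm (t := (l : ℝ) / n) (by positivity)
  refine ⟨n * M, fun l => Set.Ioc (a l) (a (l + 1)), fun l => measurableSet_Ioc, ?_, ?_⟩
  · rintro z ⟨hz, hzM⟩
    have hs : 0 < cumulativeIntensity lam α φ m z := by
      rw [← cumulativeIntensity_zero (lam := lam) (φ := φ) (m := m) hα]
      exact (cumulativeIntensity_lt_iff hlam hα hφ hm le_rfl hz.le).2 hz
    set s := cumulativeIntensity lam α φ m z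
    -- The cell of `z` is the `l` with `l < s n ≤ l + 1`.
    obtain ⟨l, hl⟩ : ∃ l, ⌈s * n⌉₊ = l + 1 :=
      Nat.exists_eq_succ_of_ne_zero (Nat.ceil_pos.2 (by positivity)).ne'
    obtain ⟨h1, h2⟩ := (Nat.ceil_eq_iff (Nat.succ_ne_zero l)).1 hl
    simp only [Nat.succ_eq_add_one, Nat.add_sub_cancel] at h1 h2
    refine Set.mem_iUnion₂.2 ⟨l, ?_, ?_, ?_⟩
    · have : (l : ℝ) < n * M := h1.trans_le (by nlinarith)
      exact Finset.mem_range.2 (by exact_mod_cast this)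
    · rw [← cumulativeIntensity_lt_iff hlam hα hφ hm (ha l) hz.le, hat, div_lt_iff₀ hn']
      exact h1
    · rw [← not_lt, ← cumulativeIntensity_lt_iff hlam hα hφ hm (ha _) hz.le, hat, not_lt,
        le_div_iff₀ hn']
      exact h2
  · have hB : ∀ l, powerAxisIntensity lam α φ m (Set.Ioc (a l) (a (l + 1))) =
        ENNReal.ofReal (1 / n) := by
      intro l
      have hle : a l ≤ a (l + 1) := by
        rw [← not_lt, ← cumulativeIntensity_lt_iff hlam hα hφ hm (ha _) (ha _), hat, hat, not_lt]
        gcongr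
        simp
      rw [← Set.Iic_sdiff_Iic, measure_sdiff (Set.Iic_subset_Iic.2 hle)
        measurableSet_Iic.nullMeasurableSet, powerAxisIntensity_Iic hlam hα hφ hm.le (ha _),
        powerAxisIntensity_Iic hlam hα hφ hm.le (ha _), hat, hat,
        ← ENNReal.ofReal_sub _ (by positivity)]
      · congr 1; push_cast; field_simp; ring
      · rw [powerAxisIntensity_Iic hlam hα hφ hm.le (ha _)]
        exact ENNReal.ofReal_ne_top
    simp_rw [hB]
    refine le_trans (le_of_eq ?_) hnε
    rw [Finset.sum_const, Finset.card_range, nsmul_eq_mul, ← ENNReal.ofReal_pow (by positivity),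
      ← ENNReal.ofReal_natCast, ← ENNReal.ofReal_mul (by positivity)]
    congr 1; push_cast; field_simp

lemma inverseDominantPDF_apply_of_pos {z : ℝ} (hz : 0 < z) (n : ℕ) :
    inverseDominantPDF lam α φ m (n + 1) z =
      Real.exp (-cumulativeIntensity lam α φ m z) * cumulativeIntensity lam α φ m z ^ n /
        n.factorial * (φ * lam / α * m * z ^ (2 / α - 1)) := by
  rw [inverseDominantPDF, if_pos hz, pow_succ, Nat.add_sub_cancel]
  have : φ * lam / α * m * z ^ (2 / α - 1) = 2 * cumulativeIntensity lam α φ m z / (α * z) := by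
    rw [cumulativeIntensity, Real.rpow_sub_one hz.ne']
    field_simp
  rw [this]
  field_simp

/-- By the chain rule the Poisson tail at mean `Λ₂(z)` has derivative `e^{-Λ₂} Λ₂ⁿ / n! · Λ₂'`,
which is the density of index `n + 1`; the tail vanishes at `z = 0`. -/
lemma withDensity_inverseDominantPDF_Iic (hlam : 0 < lam) (hα : 2 < α) (hφ : 0 < φ) (hm : 0 ≤ m)
    (n : ℕ) {z : ℝ} (hz : 0 ≤ z) :
    volume.withDensity (fun z => ENNReal.ofReal (inverseDominantPDF lam α φ m (n + 1) z))
      (Set.Iic z) = ENNReal.ofReal (1 - ∑ k ∈ Finset.range (n + 1),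
        Real.exp (-cumulativeIntensity lam α φ m z) * cumulativeIntensity lam α φ m z ^ k /
          k.factorial) := by
  have hind : ∀ t, ENNReal.ofReal (inverseDominantPDF lam α φ m (n + 1) t) = (Set.Ioi 0).indicator
      (fun t => ENNReal.ofReal (Real.exp (-cumulativeIntensity lam α φ m t) *
        cumulativeIntensity lam α φ m t ^ n / n.factorial *
          (φ * lam / α * m * t ^ (2 / α - 1)))) t := by
    intro t
    by_cases ht : 0 < t
    · rw [Set.indicator_of_mem (Set.mem_Ioi.2 ht), inverseDominantPDF_apply_of_pos ht]
    · rw [Set.indicator_of_notMem (by simpa using ht), inverseDominantPDF, if_neg ht,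
        ENNReal.ofReal_zero]
  rw [withDensity_apply _ measurableSet_Iic]
  simp_rw [hind]
  have hcont := continuous_cumulativeIntensity (lam := lam) (φ := φ) (m := m) hα
  rw [lintegral_indicator measurableSet_Ioi, Measure.restrict_restrict measurableSet_Ioi,
    Set.Ioi_inter_Iic, lintegral_Ioc_ofReal_deriv (G := fun z => 1 - ∑ k ∈ Finset.range (n + 1),
        Real.exp (-cumulativeIntensity lam α φ m z) * cumulativeIntensity lam α φ m z ^ k /
          k.factorial) hz (Continuous.continuousOn (by fun_prop)) (fun t ht => ?_) fun t ht => ?_]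
  · congr 1
    have h0 : ∑ k ∈ Finset.range (n + 1),
        Real.exp (-cumulativeIntensity lam α φ m 0) * cumulativeIntensity lam α φ m 0 ^ k /
          k.factorial = 1 := by
      rw [cumulativeIntensity_zero hα, Finset.sum_eq_single 0]
      · simp
      · intro k _ hk; simp [hk]
      · simp
    rw [h0, sub_self, sub_zero]
  · have h := (hasDerivAt_poisson_sum n (cumulativeIntensity lam α φ m t)).comp t
      (hasDerivAt_cumulativeIntensity ht.1)
    refine (h.const_sub 1).congr_deriv ?_
    ring
  · have := cumulativeIntensity_nonneg (α := α) hlam hφ hm ht.le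
    positivity

end InverseIntensity

/-! ### Almost sure ordering and the law of the inverse powers. -/

section Assembly

lemma countingMeasure_apply {ι E : Type*} [MeasurableSpace E] (p : ι → E) {B : Set E}
    (hB : MeasurableSet B) : countingMeasure p B = ({i | p i ∈ B}.encard : ℝ≥0∞) := by
  rw [← ENNReal.tsum_set_one, tsum_subtype {i | p i ∈ B} fun _ => (1 : ℝ≥0∞), countingMeasure,
    Measure.sum_apply _ hB]
  refine tsum_congr fun i => ?_
  rw [Measure.dirac_apply' _ hB]
  by_cases h : p i ∈ B <;> simp [h]

lemma powerAxisProcess_apply {α φ : ℝ} {x : EuclideanSpace ℝ (Fin 2)}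
    (X : ℕ → EuclideanSpace ℝ (Fin 2)) (h : ℕ → ℝ) {B : Set ℝ} (hB : MeasurableSet B) :
    powerAxisProcess α φ x X h B =
      ({i | i ∈ interferers φ x X ∧ ‖X i - x‖ ^ α / h i ∈ B}.encard : ℝ≥0∞) := by
  rw [powerAxisProcess, countingMeasure_apply _ hB,
    ← Function.Injective.encard_image Subtype.val_injective]
  congr 2
  ext i
  simp [and_comm]

/-- No side condition is needed, thanks to the convention `0⁻¹ = 0`. -/
lemma interferencePower_eq_inv (α : ℝ) (x y : EuclideanSpace ℝ (Fin 2)) (g : ℝ) :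
    interferencePower α x y g = (‖y - x‖ ^ α / g)⁻¹ := by
  rw [interferencePower, Real.rpow_neg (norm_nonneg _), inv_div, norm_sub_rev, div_eq_mul_inv]

/-- `dominantPower` is a supremum over an uncountable set of thresholds, so its measurability is
obtained through its sublevel sets. The exceptional set is common to all `z`, and `Z` is replaced by
`0` on a measurable null set containing it. -/
lemma aemeasurable_of_ae_Iic {Ω : Type*} [MeasurableSpace Ω] {P : Measure Ω} {Z : Ω → ℝ}
    {A : ℝ → Set Ω} (hA : ∀ z, MeasurableSet (A z)) (h : ∀ᵐ ω ∂P, ∀ z, Z ω ≤ z ↔ ω ∈ A z) :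
    AEMeasurable Z P := by
  classical
  obtain ⟨T, hT, hTm, hTP⟩ := exists_measurable_superset_of_null h
  have hgood : ∀ ω, ω ∉ T → ∀ z, Z ω ≤ z ↔ ω ∈ A z := fun ω hω => by
    by_contra hn
    exact hω (hT hn)
  refine ⟨T.piecewise (fun _ => 0) Z, measurable_of_Iic fun z => ?_, ?_⟩
  · have : T.piecewise (fun _ => 0) Z ⁻¹' Set.Iic z = T.ite ((fun _ => 0) ⁻¹' Set.Iic z) (A z) := by
      ext ω
      by_cases hω : ω ∈ T <;> simp [Set.ite, hω, hgood]
    rw [this]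
    exact hTm.ite (measurable_const measurableSet_Iic) (hA z)
  · filter_upwards [compl_mem_ae_iff.2 hTP] with ω hω
    exact (Set.piecewise_eq_of_notMem _ _ _ hω).symm

lemma hasLaw_of_ae_Iic {Ω : Type*} [MeasurableSpace Ω] {P : Measure Ω} [IsProbabilityMeasure P]
    {Z : Ω → ℝ} {A : ℝ → Set Ω} {ν : Measure ℝ} (hA : ∀ z, MeasurableSet (A z))
    (h : ∀ᵐ ω ∂P, ∀ z, Z ω ≤ z ↔ ω ∈ A z) (hν : ∀ z, P (A z) = ν (Set.Iic z)) : HasLaw Z ν P := by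
  have hZ := aemeasurable_of_ae_Iic hA h
  have := Measure.isProbabilityMeasure_map hZ
  refine ⟨hZ, Measure.ext_of_Iic _ _ fun z => ?_⟩
  rw [Measure.map_apply_of_aemeasurable hZ measurableSet_Iic, ← hν]
  refine measure_congr ?_
  filter_upwards [h] with ω hω
  exact propext (hω z)

section

variable {lam α φ m : ℝ} {x : EuclideanSpace ℝ (Fin 2)}
  {Ω : Type*} [MeasurableSpace Ω] {P : Measure Ω}
  {X : ℕ → Ω → EuclideanSpace ℝ (Fin 2)} {h : ℕ → Ω → ℝ}

/-- Almost surely the interference powers are positive, locally finite, distinct and infinitely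
many. -/
lemma ae_interferencePower (hlam : 0 < lam) (hα : 2 < α) (hφ : 0 < φ) (hm : 0 < m)
    (hXm : ∀ i, Measurable (X i)) (hhm : ∀ i, Measurable (h i))
    (hN : IsPoissonPointProcess
      (fun ω => powerAxisProcess α φ x (fun i => X i ω) (fun i => h i ω))
      (powerAxisIntensity lam α φ m) P)
    (hL : ∫⁻ ω, expNeg (powerAxisProcess α φ x (fun i => X i ω) (fun i => h i ω) Set.univ) ∂P =
      expNeg ((1 - expNeg 1) * powerAxisIntensity lam α φ m Set.univ)) :
    ∀ᵐ ω ∂P,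
      (∀ i ∈ interferers φ x fun i => X i ω, 0 < interferencePower α x (X i ω) (h i ω)) ∧
      (∀ t, 0 < t → {i | i ∈ interferers φ x (fun i => X i ω) ∧
        t ≤ interferencePower α x (X i ω) (h i ω)}.Finite) ∧
      Set.InjOn (fun i => interferencePower α x (X i ω) (h i ω))
        (interferers φ x fun i => X i ω) ∧
      (interferers φ x fun i => X i ω).Infinite := by
  have hfinite : ∀ᵐ ω ∂P, ∀ k : ℕ,
      powerAxisProcess α φ x (fun i => X i ω) (fun i => h i ω) (Set.Iic (k : ℝ)) ≠ ∞ :=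
    ae_all_iff.2 fun k => hN.ae_count_ne_top measurableSet_Iic (by
      rw [powerAxisIntensity_Iic hlam hα hφ hm.le k.cast_nonneg]
      exact ENNReal.ofReal_ne_top)
  have hzero : ∀ᵐ ω ∂P,
      powerAxisProcess α φ x (fun i => X i ω) (fun i => h i ω) (Set.Iic 0) = 0 :=
    hN.ae_count_eq_zero measurableSet_Iic (by
      rw [powerAxisIntensity_Iic hlam hα hφ hm.le le_rfl, cumulativeIntensity_zero hα,
        ENNReal.ofReal_zero])
  have hties : ∀ᵐ ω ∂P, ∀ M : ℕ, ∀ z ∈ {z | 0 < z ∧ cumulativeIntensity lam α φ m z ≤ M},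
      powerAxisProcess α φ x (fun i => X i ω) (fun i => h i ω) {z} < 2 :=
    ae_all_iff.2 fun M => hN.ae_count_singleton_lt_two fun ε hε =>
      exists_cover_powerAxisIntensity hlam hα hφ hm M hε
  -- The Poisson property speaks only of sets of finite intensity, hence the appeal to the Laplace
  -- functional: infinite total intensity gives `E e^{-N(ℝ)} = 0`.
  have hinf : ∀ᵐ ω ∂P,
      powerAxisProcess α φ x (fun i => X i ω) (fun i => h i ω) Set.univ = ∞ := by
    have h1 : expNeg 1 < 1 := by
      refine lt_of_le_of_ne (expNeg_le_one 1) fun h => ?_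
      exact one_ne_zero (expNeg_injective (h.trans expNeg_zero.symm))
    rw [powerAxisIntensity_univ hlam hα hφ hm, ENNReal.mul_top (tsub_pos_of_lt h1).ne',
      expNeg_top] at hL
    have hmeas : Measurable fun ω =>
        expNeg (powerAxisProcess α φ x (fun i => X i ω) (fun i => h i ω) Set.univ) :=
      measurable_expNeg.comp
        ((Measure.measurable_coe MeasurableSet.univ).comp (measurable_powerAxisProcess hXm hhm))
    rw [lintegral_eq_zero_iff hmeas] at hL
    filter_upwards [hL] with ω hω
    exact expNeg_injective (hω.trans expNeg_top.symm)
  filter_upwards [hfinite, hzero, hties, hinf] with ω hfinite hzero hties hinf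
  rw [powerAxisProcess_apply _ _ measurableSet_Iic] at hzero
  have hp : ∀ i ∈ interferers φ x fun i => X i ω, 0 < ‖X i ω - x‖ ^ α / h i ω := by
    intro i hi
    by_contra! hle
    have h0 : {i | i ∈ interferers φ x (fun i => X i ω) ∧
        ‖X i ω - x‖ ^ α / h i ω ∈ Set.Iic 0} = ∅ := by simpa using hzero
    exact (h0 ▸ (⟨hi, hle⟩ : i ∈ {i | i ∈ interferers φ x (fun i => X i ω) ∧
        ‖X i ω - x‖ ^ α / h i ω ∈ Set.Iic 0}) : i ∈ (∅ : Set ℕ))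
  simp only [interferencePower_eq_inv]
  refine ⟨fun i hi => inv_pos.2 (hp i hi), fun t ht => ?_, fun i hi j hj hij => ?_, ?_⟩
  · obtain ⟨k, hk⟩ := exists_nat_ge t⁻¹
    have hf := hfinite k
    rw [powerAxisProcess_apply _ _ measurableSet_Iic] at hf
    have hf' : {i | i ∈ interferers φ x (fun i => X i ω) ∧
        ‖X i ω - x‖ ^ α / h i ω ∈ Set.Iic (k : ℝ)}.Finite := by
      rw [← Set.encard_ne_top_iff]
      intro htop
      rw [htop] at hf
      exact hf rfl
    exact hf'.subset fun i hi =>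
      ⟨hi.1, ((le_inv_comm₀ ht (hp i hi.1)).1 hi.2).trans hk⟩
  · by_contra hne
    have hij' := inv_injective hij
    obtain ⟨M, hM⟩ := exists_nat_ge (cumulativeIntensity lam α φ m (‖X i ω - x‖ ^ α / h i ω))
    have hlt := hties M _ ⟨hp i hi, hM⟩
    rw [powerAxisProcess_apply _ _ (measurableSet_singleton _)] at hlt
    refine absurd hlt (not_lt.2 ?_)
    refine (ENat.toENNReal_le (m := 2)).2 ?_
    refine (Set.encard_pair hne).symm.trans_le ?_
    refine Set.encard_le_encard fun k hk => ?_
    rcases hk with rfl | rfl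
    · exact ⟨hi, rfl⟩
    · exact ⟨hj, hij'.symm⟩
  · rw [powerAxisProcess_apply _ _ MeasurableSet.univ] at hinf
    simpa using hinf

/-- The law of the inverse of the `n`-th dominant interference power. -/
lemma hasLaw_inv_dominantPower [IsProbabilityMeasure P] (hlam : 0 < lam) (hα : 2 < α)
    (hφ : 0 < φ) (hm : 0 ≤ m) (hXm : ∀ i, Measurable (X i)) (hhm : ∀ i, Measurable (h i))
    (hN : IsPoissonPointProcess
      (fun ω => powerAxisProcess α φ x (fun i => X i ω) (fun i => h i ω))
      (powerAxisIntensity lam α φ m) P)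
    (hgood : ∀ᵐ ω ∂P,
      (∀ i ∈ interferers φ x fun i => X i ω, 0 < interferencePower α x (X i ω) (h i ω)) ∧
      (∀ t, 0 < t → {i | i ∈ interferers φ x (fun i => X i ω) ∧
        t ≤ interferencePower α x (X i ω) (h i ω)}.Finite) ∧
      Set.InjOn (fun i => interferencePower α x (X i ω) (h i ω))
        (interferers φ x fun i => X i ω) ∧
      (interferers φ x fun i => X i ω).Infinite) (n : ℕ) :
    HasLaw (fun ω => (dominantPower α φ x (fun i => X i ω) (fun i => h i ω) (n + 1))⁻¹)
      (volume.withDensity fun z => ENNReal.ofReal (inverseDominantPDF lam α φ m (n + 1) z)) P := by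
  have hNm : Measurable fun ω => powerAxisProcess α φ x (fun i => X i ω) (fun i => h i ω) :=
    measurable_powerAxisProcess hXm hhm
  -- The inverse power is at most `z > 0` exactly when at least `n + 1` points are at most `z`. It
  -- is almost surely positive, so the event is empty for `z ≤ 0`.
  refine hasLaw_of_ae_Iic (A := fun z => {ω | 0 < z ∧ ((n + 1 : ℕ) : ℝ≥0∞) ≤
    powerAxisProcess α φ x (fun i => X i ω) (fun i => h i ω) (Set.Iic z)}) (fun z => ?_) ?_
    fun z => ?_
  · exact (MeasurableSet.const _).inter
      (measurableSet_le measurable_const ((Measure.measurable_coe measurableSet_Iic).comp hNm))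
  · filter_upwards [hgood] with ω hω z
    obtain ⟨hpos, hfin, hinj, hinf⟩ := hω
    have hd := nthLargest_pos hpos hfin hinj hinf (Nat.le_add_left 1 n)
    change _ ↔ 0 < z ∧ _
    rcases lt_or_ge 0 z with hz | hz
    · rw [dominantPower, inv_le_comm₀ hd hz,
        le_nthLargest_iff hpos hfin hinj hinf (Nat.le_add_left 1 n),
        powerAxisProcess_apply _ _ measurableSet_Iic, ← ENat.toENNReal_coe,
        ENat.toENNReal_le]
      have : {i | i ∈ interferers φ x (fun i => X i ω) ∧
          z⁻¹ ≤ interferencePower α x (X i ω) (h i ω)} =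
          {i | i ∈ interferers φ x (fun i => X i ω) ∧ ‖X i ω - x‖ ^ α / h i ω ∈ Set.Iic z} := by
        ext i
        simp only [Set.mem_ofPred_eq, Set.mem_Iic]
        refine and_congr_right fun hi => ?_
        have hi' := hpos i hi
        rw [interferencePower_eq_inv] at hi' ⊢
        exact inv_le_inv₀ hz (inv_pos.1 hi')
      rw [this]
      simp [hz]
    · exact iff_of_false (not_le.2 (hz.trans_lt (inv_pos.2 hd))) fun h => absurd h.1 (not_lt.2 hz)
  · rcases lt_or_ge 0 z with hz | hz
    · have hν := powerAxisIntensity_Iic (m := m) hlam hα hφ hm hz.le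
      have hP := hN.measure_le_count (B := Set.Iic z) measurableSet_Iic
        (hν ▸ ENNReal.ofReal_ne_top) (n + 1)
      rw [hν, ENNReal.toReal_ofReal (cumulativeIntensity_nonneg hlam hφ hm hz.le)] at hP
      rw [withDensity_inverseDominantPDF_Iic hlam hα hφ hm n hz.le, ← hP]
      simp [hz]
    · rw [withDensity_apply _ measurableSet_Iic, setLIntegral_congr_fun (g := fun _ => 0)
        measurableSet_Iic, lintegral_zero]
      · simp [not_lt.2 hz]
      · intro t ht
        have : ¬ 0 < t := not_lt.2 (le_trans ht hz)
        simp [inverseDominantPDF, this]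

end

end Assembly

theorem theorem1 {Ω : Type*} [MeasurableSpace Ω] (P : Measure Ω) [IsProbabilityMeasure P]
    (lam α φ : ℝ) (hlam : 0 < lam) (hα : 2 < α) (hφ : 0 < φ) (hφ' : φ ≤ 2 * Real.pi)
    (x : EuclideanSpace ℝ (Fin 2))
    -- the nodes: a homogeneous Poisson point process of intensity `lam` in the plane
    (X : ℕ → Ω → EuclideanSpace ℝ (Fin 2)) (hXm : ∀ i, Measurable (X i))
    (hX : IsPoissonPointProcess (fun ω => countingMeasure fun i => X i ω)
      (ENNReal.ofReal lam • volume) P)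
    -- the channel gains: positive, i.i.d. with law `μh`, independent of the nodes
    (μh : Measure ℝ) (h : ℕ → Ω → ℝ) (hhm : ∀ i, Measurable (h i))
    (hlaw : ∀ i, HasLaw (h i) μh P) (hindep : iIndepFun h P)
    (hXh : IndepFun (fun ω i => X i ω) (fun ω i => h i ω) P)
    (hpos : ∀ᵐ g ∂μh, 0 < g) (hint : Integrable (fun g => g ^ (2 / α)) μh) :
    -- almost surely the interference powers have no ties and are listed by `I₁ > I₂ > ⋯`
    (∀ᵐ ω ∂P,
      Set.InjOn (fun i => interferencePower α x (X i ω) (h i ω))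
          (interferers φ x fun i => X i ω) ∧
        StrictAntiOn (dominantPower α φ x (fun i => X i ω) (fun i => h i ω)) (Set.Ici 1) ∧
        dominantPower α φ x (fun i => X i ω) (fun i => h i ω) '' Set.Ici 1 =
          (fun i => interferencePower α x (X i ω) (h i ω)) ''
            (interferers φ x fun i => X i ω)) ∧
    -- the density of `zₙ = Iₙ⁻¹`
    (∀ n : ℕ, 1 ≤ n →
      HasLaw (fun ω => (dominantPower α φ x (fun i => X i ω) (fun i => h i ω) n)⁻¹)
        (volume.withDensity fun z =>
          ENNReal.ofReal (inverseDominantPDF lam α φ (∫ g, g ^ (2 / α) ∂μh) n z)) P) ∧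
    -- the points `‖xᵢ - x‖ ^ α / hᵢ` form a Poisson point process with intensity measure `Λ₂`
    IsPoissonPointProcess
      (fun ω => powerAxisProcess α φ x (fun i => X i ω) (fun i => h i ω))
      (powerAxisIntensity lam α φ (∫ g, g ^ (2 / α) ∂μh)) P ∧
    (∀ z : ℝ, 0 ≤ z →
      powerAxisIntensity lam α φ (∫ g, g ^ (2 / α) ∂μh) (Set.Icc 0 z) =
        ENNReal.ofReal (cumulativeIntensity lam α φ (∫ g, g ^ (2 / α) ∂μh) z)) := by
  have : IsProbabilityMeasure μh := (hlaw 0).isProbabilityMeasure_iff.1 inferInstance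
  -- Strict positivity makes `Λ₂` strictly increasing and unbounded, as the absence of ties and the
  -- infinity of interferers require.
  have hm : 0 < ∫ g, g ^ (2 / α) ∂μh := by
    have hpos' : ∀ᵐ g ∂μh, 0 < g ^ (2 / α) := hpos.mono fun g hg => Real.rpow_pos_of_pos hg _
    refine (integral_nonneg_of_ae (hpos'.mono fun g hg => hg.le)).lt_of_ne' fun h0 => ?_
    rw [integral_eq_zero_iff_of_nonneg_ae (hpos'.mono fun g hg => hg.le) hint] at h0
    obtain ⟨g, hg, hg0⟩ := (hpos'.and h0).exists
    exact hg.ne' hg0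
  have hL : ∀ u : ℝ → ℝ≥0∞, Measurable u →
      ∫⁻ ω, expNeg (∫⁻ z, u z ∂(powerAxisProcess α φ x (fun i => X i ω) (fun i => h i ω))) ∂P =
        expNeg (∫⁻ z, (1 - expNeg (u z))
          ∂(powerAxisIntensity lam α φ (∫ g, g ^ (2 / α) ∂μh))) := fun u hu =>
    lintegral_expNeg_powerAxisProcess hlam hα hφ hφ' hXm hX hhm hlaw hindep hXh hpos hint hu
  have hN := IsPoissonPointProcess.of_lintegral_expNeg (measurable_powerAxisProcess hXm hhm) hL
  have hL1 := hL (fun _ => 1) measurable_const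
  simp only [lintegral_const, one_mul] at hL1
  have hgood := ae_interferencePower hlam hα hφ hm hXm hhm hN hL1
  refine ⟨?_, fun n hn => ?_, hN, fun z hz => powerAxisIntensity_Icc hlam hα hφ hm.le hz⟩
  · filter_upwards [hgood] with ω hω
    obtain ⟨hpos, hfin, hinj, hinf⟩ := hω
    exact ⟨hinj, strictAntiOn_nthLargest hpos hfin hinj hinf, image_nthLargest hpos hfin hinj hinf⟩
  · obtain ⟨n, rfl⟩ := Nat.exists_eq_add_of_le' hn
    exact hasLaw_inv_dominantPower hlam hα hφ hm.le hXm hhm hN hgood n
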